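/- Let $\Omega\subset\mathbb R^n$ be a bounded, nonempty, connected open set with $C^1$ boundary $\Gamma=\partial\Omega$ (near each boundary point, $\Omega=\{\rho<0\}$ for a $C^1$ function $\rho$ with nonvanishing gradient) and outer unit normal $\nu$. Let $H:\overline\Omega\times\mathbb R^n\to\mathbb R$, $g:\Gamma\to\mathbb R$ and $\gamma:\Gamma\to\mathbb R^n$ be continuous, and assume that for every $x\in\overline\Omega$ the function $H(x,\cdot)$ is convex with $H(x,p)\to\infty$ as $|p|\to\infty$, and that $\nu(x)\cdot\gamma(x)>0$ for every $x\in\Gamma$. Write $D_\gamma\phi=\gamma\cdot D\phi$. For $a\in\mathbb R$ consider the problem $$(\mathrm P_a)\qquad H(x,Du(x))=a\ \text{ in }\Omega,\qquad D_\gamma u(x)=g(x)\ \text{ on }\Gamma .$$ For $u:\overline\Omega\to\mathbb R$ let $u^*$ and $u_*$ be its upper and lower semicontinuous envelopes on $\overline\Omega$. The function $u$ is a (viscosity) subsolution of $(\mathrm P_a)$ if it is bounded above and, whenever $\phi\in C^1(\overline\Omega)$ and $u^*-\phi$ attains its maximum over $\overline\Omega$ at $x$, one has $H(x,D\phi(x))\le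 a$ if $x\in\Omega$, and $H(x,D\phi(x))\le a$ or $D_\gamma\phi(x)\le g(x)$ if $x\in\Gamma$. It is a supersolution of $(\mathrm P_a)$ if it is bounded below and, whenever $\phi\in C^1(\overline\Omega)$ and $u_*-\phi$ attains its minimum over $\overline\Omega$ at $x$, one has $H(x,D\phi(x))\ge a$ if $x\in\Omega$, and $H(x,D\phi(x))\ge a$ or $D_\gamma\phi(x)\ge g(x)$ if $x\in\Gamma$. It is a solution if it is both. Let $$c=\inf\{a\in\mathbb R:\ (\mathrm P_a)\text{ has a subsolution}\}$$ be the critical value, and assume that it is normalized: $c=0$. For $x,y\in\overline\Omega$ set $$d(x,y)=\sup\{v(x)-v(y):\ v\text{ is an upper semicontinuous subsolution of }(\mathrm P_0)\},$$ and define the Aubry–Mather set $$\mathcal A=\{y\in\overline\Omega:\ d(\cdot,y)\text{ is a (real-valued) solution of }(\mathrm P_0)\}.$$ Then $\mathcal A$ is nonempty and compact. -/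

import Mathlib

open Set Filter Topology

namespace NeumannHJ

noncomputable section

/-- `ρ` is a `C¹` defining function of `Ω` near the point `z`: near `z` the set `Ω` is `{ρ < 0}`,
and the gradient of `ρ` does not vanish at `z`. -/
def IsLocalDefiningFunction {n : ℕ} (Ω : Set (EuclideanSpace ℝ (Fin n)))
    (z : EuclideanSpace ℝ (Fin n)) (ρ : EuclideanSpace ℝ (Fin n) → ℝ) : Prop :=
  ContDiffAt ℝ 1 ρ z ∧ gradient ρ z ≠ 0 ∧ ∀ᶠ x in 𝓝 z, (x ∈ Ω ↔ ρ x < 0)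

/-- `Ω` has a `C¹` boundary (and lies locally on one side of it). -/
def HasC1Boundary {n : ℕ} (Ω : Set (EuclideanSpace ℝ (Fin n))) : Prop :=
  ∀ z ∈ frontier Ω, ∃ ρ : EuclideanSpace ℝ (Fin n) → ℝ, IsLocalDefiningFunction Ω z ρ

/-- `ν` is the outer unit normal vector of `Ω` at the boundary point `z`. -/
def IsOuterUnitNormal {n : ℕ} (Ω : Set (EuclideanSpace ℝ (Fin n)))
    (z ν : EuclideanSpace ℝ (Fin n)) : Prop :=
  ∃ ρ : EuclideanSpace ℝ (Fin n) → ℝ,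
    IsLocalDefiningFunction Ω z ρ ∧ ν = ‖gradient ρ z‖⁻¹ • gradient ρ z

/-- The vector field `γ` is oblique to the boundary of `Ω`: `ν(z) · γ(z) > 0` on `∂Ω`. -/
def IsOblique {n : ℕ} (Ω : Set (EuclideanSpace ℝ (Fin n)))
    (γ : EuclideanSpace ℝ (Fin n) → EuclideanSpace ℝ (Fin n)) : Prop :=
  ∀ z ∈ frontier Ω, ∀ ν : EuclideanSpace ℝ (Fin n), IsOuterUnitNormal Ω z ν →
    0 < inner ℝ ν (γ z)

/-- The upper semicontinuous envelope `u^*` on `closure Ω` of a function `u` on `closure Ω`.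
Only the values of `u` on `closure Ω` matter. At a point `x ∈ closure Ω` the neighbourhoods used
contain `x` itself, so for `u` bounded above this `limsup` is a genuine real number `≥ u x`. -/
def upperEnvelope {n : ℕ} (Ω : Set (EuclideanSpace ℝ (Fin n)))
    (u : EuclideanSpace ℝ (Fin n) → ℝ) (x : EuclideanSpace ℝ (Fin n)) : ℝ :=
  limsup u (𝓝[closure Ω] x)

/-- The lower semicontinuous envelope `u_*` on `closure Ω` of a function `u` on `closure Ω`. -/
def lowerEnvelope {n : ℕ} (Ω : Set (EuclideanSpace ℝ (Fin n)))
    (u : EuclideanSpace ℝ (Fin n) → ℝ) (x : EuclideanSpace ℝ (Fin n)) : ℝ :=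
  liminf u (𝓝[closure Ω] x)

/-- `u` (a function on `closure Ω`; its other values are irrelevant) is a viscosity subsolution of
`H(x, Du) = a` in `Ω`, `γ · Du = g` on `∂Ω`. The test functions of class `C¹(closure Ω)` are the
restrictions to `closure Ω` of `C¹` functions on the whole space. -/
def IsSubsolution {n : ℕ} (Ω : Set (EuclideanSpace ℝ (Fin n)))
    (H : EuclideanSpace ℝ (Fin n) → EuclideanSpace ℝ (Fin n) → ℝ)
    (γ : EuclideanSpace ℝ (Fin n) → EuclideanSpace ℝ (Fin n))
    (g : EuclideanSpace ℝ (Fin n) → ℝ) (a : ℝ) (u : EuclideanSpace ℝ (Fin n) → ℝ) : Prop :=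
  BddAbove (u '' closure Ω) ∧
    ∀ x ∈ closure Ω, ∀ φ : EuclideanSpace ℝ (Fin n) → ℝ, ContDiff ℝ 1 φ →
      IsMaxOn (fun z => upperEnvelope Ω u z - φ z) (closure Ω) x →
        (x ∈ Ω → H x (gradient φ x) ≤ a) ∧
        (x ∈ frontier Ω → H x (gradient φ x) ≤ a ∨ inner ℝ (γ x) (gradient φ x) ≤ g x)

/-- `u` is a viscosity supersolution of `H(x, Du) = a` in `Ω`, `γ · Du = g` on `∂Ω`. -/
def IsSupersolution {n : ℕ} (Ω : Set (EuclideanSpace ℝ (Fin n)))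
    (H : EuclideanSpace ℝ (Fin n) → EuclideanSpace ℝ (Fin n) → ℝ)
    (γ : EuclideanSpace ℝ (Fin n) → EuclideanSpace ℝ (Fin n))
    (g : EuclideanSpace ℝ (Fin n) → ℝ) (a : ℝ) (u : EuclideanSpace ℝ (Fin n) → ℝ) : Prop :=
  BddBelow (u '' closure Ω) ∧
    ∀ x ∈ closure Ω, ∀ φ : EuclideanSpace ℝ (Fin n) → ℝ, ContDiff ℝ 1 φ →
      IsMinOn (fun z => lowerEnvelope Ω u z - φ z) (closure Ω) x →
        (x ∈ Ω → a ≤ H x (gradient φ x)) ∧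
        (x ∈ frontier Ω → a ≤ H x (gradient φ x) ∨ g x ≤ inner ℝ (γ x) (gradient φ x))

/-- `u` is a (bounded) viscosity solution of `H(x, Du) = a` in `Ω`, `γ · Du = g` on `∂Ω`. -/
def IsSolution {n : ℕ} (Ω : Set (EuclideanSpace ℝ (Fin n)))
    (H : EuclideanSpace ℝ (Fin n) → EuclideanSpace ℝ (Fin n) → ℝ)
    (γ : EuclideanSpace ℝ (Fin n) → EuclideanSpace ℝ (Fin n))
    (g : EuclideanSpace ℝ (Fin n) → ℝ) (a : ℝ) (u : EuclideanSpace ℝ (Fin n) → ℝ) : Prop :=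
  IsSubsolution Ω H γ g a u ∧ IsSupersolution Ω H γ g a u

/-- The critical value (additive eigenvalue): the infimum, taken in the extended reals, of the
`a ∈ ℝ` for which the problem with right-hand side `a` has a subsolution. -/
def criticalValue {n : ℕ} (Ω : Set (EuclideanSpace ℝ (Fin n)))
    (H : EuclideanSpace ℝ (Fin n) → EuclideanSpace ℝ (Fin n) → ℝ)
    (γ : EuclideanSpace ℝ (Fin n) → EuclideanSpace ℝ (Fin n))
    (g : EuclideanSpace ℝ (Fin n) → ℝ) : EReal :=
  sInf {r : EReal | ∃ a : ℝ, r = (a : EReal) ∧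
    ∃ u : EuclideanSpace ℝ (Fin n) → ℝ, IsSubsolution Ω H γ g a u}

/-- `d(x, y) = sup {v(x) - v(y) : v an upper semicontinuous subsolution}`, in the extended
reals. -/
def semidistance {n : ℕ} (Ω : Set (EuclideanSpace ℝ (Fin n)))
    (H : EuclideanSpace ℝ (Fin n) → EuclideanSpace ℝ (Fin n) → ℝ)
    (γ : EuclideanSpace ℝ (Fin n) → EuclideanSpace ℝ (Fin n))
    (g : EuclideanSpace ℝ (Fin n) → ℝ) (a : ℝ) (x y : EuclideanSpace ℝ (Fin n)) : EReal :=
  sSup {r : EReal | ∃ v : EuclideanSpace ℝ (Fin n) → ℝ,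
    UpperSemicontinuousOn v (closure Ω) ∧ IsSubsolution Ω H γ g a v ∧
      r = ((v x - v y : ℝ) : EReal)}

/-- The Aubry–Mather set: the points `y ∈ closure Ω` for which `d(·, y)` is (a real-valued
function on `closure Ω` and) a solution. -/
def aubryMatherSet {n : ℕ} (Ω : Set (EuclideanSpace ℝ (Fin n)))
    (H : EuclideanSpace ℝ (Fin n) → EuclideanSpace ℝ (Fin n) → ℝ)
    (γ : EuclideanSpace ℝ (Fin n) → EuclideanSpace ℝ (Fin n))
    (g : EuclideanSpace ℝ (Fin n) → ℝ) (a : ℝ) : Set (EuclideanSpace ℝ (Fin n)) :=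
  {y | y ∈ closure Ω ∧ ∃ u : EuclideanSpace ℝ (Fin n) → ℝ,
    (∀ x ∈ closure Ω, semidistance Ω H γ g a x y = (u x : EReal)) ∧ IsSolution Ω H γ g a u}

end

end NeumannHJ

namespace NeumannHJ

/-! Viscosity conditions are read on superdifferentials relative to the closure of Ω. Coercivity
bounds gradients where the equation holds, and obliquity gives barriers that exclude the boundary
alternative, so semicontinuous subsolutions at a fixed level are continuous and locally
equi-Lipschitz (`exists_local_lipschitz`). As Ω is connected, differences v(x) - v(y) are bounded
uniformly over all subsolutions v. Their supremum d(·, y), called `maxSub`, is then finite and is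
itself a subsolution. Decreasing limits over levels tending to 0 give a subsolution at the critical
level.

If d(·, y) fails to be a supersolution at x, Perron's method raises it near x to another subsolution
(`exists_bump`). For x ≠ y this contradicts maximality, so y lies in the Aubry-Mather set exactly
when the supersolution test holds at y itself.

Compactness: by the triangle inequality d(·, y) depends on y continuously in the uniform norm, and
the supersolution property passes to uniform limits; hence the set is closed.

Nonemptiness: if every y failed, each would have a subsolution at level 0 that is strict near y.
Averaging finitely many of them would give a subsolution at a negative level, against c = 0
(`exists_neg_level`).

The averaging is the delicate point, since the boundary alternative "H ≤ a or γ·p ≤ g" is not convex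
in p. For Lipschitz functions it is equivalent to a tangential form: for every superdifferential p
of the restriction to the boundary, some p + s n on the normal line satisfies both H ≤ a and γ·(p +
s n) ≤ g (`exists_smul_of_subAt`, `subAt_of_exists_smul`). This conjunction is convex and closed, so
it survives averaging (`subAt_half_add`). -/

theorem isLocalMaxOn_of_inter_closedBall {X : Type*} [PseudoMetricSpace X] {S : Set X}
    {f : X → ℝ} {z x : X} {r : ℝ} (hx : dist x z < r)
    (h : ∀ y ∈ S ∩ Metric.closedBall z r, f y ≤ f x) : IsLocalMaxOn f S x := by
  have : Metric.ball z r ∈ 𝓝 x := Metric.isOpen_ball.mem_nhds hx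
  filter_upwards [self_mem_nhdsWithin, mem_nhdsWithin_of_mem_nhds this] with y hy hy'
  exact h y ⟨hy, Metric.ball_subset_closedBall hy'⟩

theorem exists_closedBall_of_eventually {X : Type*} [PseudoMetricSpace X] {P : X → Prop}
    {z : X} (h : ∀ᶠ y in 𝓝 z, P y) : ∃ r > 0, ∀ y ∈ Metric.closedBall z r, P y :=
  Metric.nhds_basis_closedBall.mem_iff.1 h

theorem exists_closedBall_of_eventually_within {X : Type*} [PseudoMetricSpace X] {S : Set X}
    {P : X → Prop} {z : X}
    (h : ∀ᶠ y in 𝓝[S] z, P y) : ∃ r > 0, ∀ y ∈ S ∩ Metric.closedBall z r, P y := by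
  obtain ⟨r, hr, h'⟩ := exists_closedBall_of_eventually (eventually_nhdsWithin_iff.1 h)
  exact ⟨r, hr, fun y hy => h' y hy.2 hy.1⟩

/-! ### Superdifferentials defined by C¹ test functions -/

section Superdifferential

variable {E : Type*} [NormedAddCommGroup E] [InnerProductSpace ℝ E] [FiniteDimensional ℝ E]

/-- `φ` is of class `C¹` near `x`, with gradient `p` at `x`. -/
structure C1At (φ : E → ℝ) (p x : E) : Prop where
  contDiffAt : ContDiffAt ℝ 1 φ x
  hasGradientAt : HasGradientAt φ p x

namespace C1At

variable {φ ψ : E → ℝ} {p q x : E}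

theorem of_contDiffAt (h : ContDiffAt ℝ 1 φ x) : C1At φ (gradient φ x) x :=
  ⟨h, (h.differentiableAt one_ne_zero).hasGradientAt⟩

theorem of_hasFDerivAt (h : ContDiffAt ℝ 1 φ x) {L : E →L[ℝ] ℝ} (hL : HasFDerivAt φ L x)
    (hp : ∀ w, L w = inner ℝ p w) : C1At φ p x := by
  refine ⟨h, hasGradientAt_iff_hasFDerivAt.2 ?_⟩
  have : InnerProductSpace.toDual ℝ E p = L := by
    ext w
    simp [hp]
  rwa [this]

theorem hasFDerivAt (h : C1At φ p x) : HasFDerivAt φ (InnerProductSpace.toDual ℝ E p) x :=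
  hasGradientAt_iff_hasFDerivAt.1 h.hasGradientAt

theorem add (h : C1At φ p x) (h' : C1At ψ q x) : C1At (fun y => φ y + ψ y) (p + q) x :=
  of_hasFDerivAt (h.contDiffAt.add h'.contDiffAt) (h.hasFDerivAt.add h'.hasFDerivAt)
    fun w => by simp [inner_add_left]

theorem sub (h : C1At φ p x) (h' : C1At ψ q x) : C1At (fun y => φ y - ψ y) (p - q) x :=
  of_hasFDerivAt (h.contDiffAt.sub h'.contDiffAt) (h.hasFDerivAt.sub h'.hasFDerivAt)
    fun w => by simp [inner_sub_left]

theorem const_mul (h : C1At φ p x) (c : ℝ) : C1At (fun y => c * φ y) (c • p) x :=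
  of_hasFDerivAt (contDiffAt_const.mul h.contDiffAt) (h.hasFDerivAt.const_mul c)
    fun w => by simp [inner_smul_left]

theorem add_const (h : C1At φ p x) (c : ℝ) : C1At (fun y => φ y + c) p x :=
  of_hasFDerivAt (h.contDiffAt.add contDiffAt_const) (h.hasFDerivAt.add_const c)
    fun w => by simp

theorem comp {f : ℝ → ℝ} {f' : ℝ} (hf : ContDiffAt ℝ 1 f (φ x)) (hf' : HasDerivAt f f' (φ x))
    (h : C1At φ p x) : C1At (fun y => f (φ y)) (f' • p) x :=
  of_hasFDerivAt (hf.comp x h.contDiffAt) (hf'.comp_hasFDerivAt x h.hasFDerivAt)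
    fun w => by simp [inner_smul_left]

theorem norm_sub_sq (a x : E) : C1At (fun y => ‖y - a‖ ^ 2) ((2 : ℝ) • (x - a)) x := by
  refine of_hasFDerivAt ((contDiff_id.sub contDiff_const).norm_sq ℝ).contDiffAt
    (((hasFDerivAt_id x).sub_const a).norm_sq) fun w => ?_
  simp [inner_smul_left, inner_sub_left]

theorem eventually (h : C1At φ p x) : ∀ᶠ y in 𝓝 x, C1At φ (gradient φ y) y :=
  (h.contDiffAt.eventually (by simp)).mono fun _ hy => of_contDiffAt hy

theorem gradient_eq (h : C1At φ p x) : gradient φ x = p := h.hasGradientAt.gradient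

theorem continuousAt_gradient (h : C1At φ p x) : ContinuousAt (gradient φ) x := by
  have h1 : ContinuousAt (fderiv ℝ φ) x := h.contDiffAt.continuousAt_fderiv one_ne_zero
  exact (InnerProductSpace.toDual ℝ E).symm.continuous.continuousAt.comp h1

theorem continuousAt (h : C1At φ p x) : ContinuousAt φ x := h.contDiffAt.continuousAt

theorem congr (h : C1At φ p x) (he : ψ =ᶠ[𝓝 x] φ) : C1At ψ p x :=
  ⟨h.contDiffAt.congr_of_eventuallyEq he, h.hasGradientAt.congr_of_eventuallyEq he⟩

/-- First order expansion, uniform in the two points. -/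
theorem strict_expansion (h : C1At φ p x) {ε : ℝ} (hε : 0 < ε) :
    ∃ r > 0, ∀ y ∈ Metric.closedBall x r, ∀ w ∈ Metric.closedBall x r,
      |φ y - φ w - inner ℝ p (y - w)| ≤ ε * ‖y - w‖ := by
  have h1 : HasStrictFDerivAt φ (InnerProductSpace.toDual ℝ E p) x := by
    rw [← h.hasFDerivAt.fderiv]
    exact h.contDiffAt.hasStrictFDerivAt one_ne_zero
  have h2 := h1.isLittleO.def hε
  rw [nhds_prod_eq] at h2
  obtain ⟨s, hs, hs'⟩ := mem_prod_self_iff.1 h2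
  obtain ⟨r, hr, hrs⟩ := Metric.nhds_basis_closedBall.mem_iff.1 hs
  exact ⟨r, hr, fun y hy w hw => by simpa using hs' (mk_mem_prod (hrs hy) (hrs hw))⟩

theorem exists_lipschitz (h : C1At φ p x) : ∃ K ≥ 0, ∃ r > 0, ∀ y ∈ Metric.closedBall x r,
    ∀ w ∈ Metric.closedBall x r, |φ y - φ w| ≤ K * ‖y - w‖ := by
  obtain ⟨r, hr, hr'⟩ := h.strict_expansion one_pos
  refine ⟨‖p‖ + 1, by positivity, r, hr, fun y hy w hw => ?_⟩
  have h1 := abs_le.1 (hr' y hy w hw)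
  have h2 := abs_le.1 (abs_real_inner_le_norm p (y - w))
  rw [abs_le]
  constructor <;> nlinarith

end C1At

/-- The `C¹` superdifferential, relative to `S`, of the function `u` at `x`. -/
def superdiff (S : Set E) (u : E → ℝ) (x : E) : Set E :=
  {p | ∃ φ : E → ℝ, C1At φ p x ∧ IsLocalMaxOn (fun y => u y - φ y) S x}

theorem superdiff_mono {S T : Set E} (h : S ⊆ T) (u : E → ℝ) (x : E) :
    superdiff T u x ⊆ superdiff S u x := by
  rintro p ⟨φ, hφ, hmax⟩
  exact ⟨φ, hφ, hmax.on_subset h⟩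

theorem superdiff_subset_of_eventuallyEq {S : Set E} {u v : E → ℝ} {x : E}
    (h : ∀ᶠ y in 𝓝[S] x, v y ≤ u y) (hx : v x = u x) : superdiff S u x ⊆ superdiff S v x := by
  rintro p ⟨φ, hφ, hmax⟩
  refine ⟨φ, hφ, ?_⟩
  filter_upwards [hmax, h] with y h1 h2
  rw [hx]
  linarith

theorem superdiff_add_const {S : Set E} {u : E → ℝ} {x : E} (c : ℝ) :
    superdiff S (fun y => u y + c) x ⊆ superdiff S u x := by
  rintro p ⟨φ, hφ, hmax⟩
  refine ⟨φ, hφ, ?_⟩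
  filter_upwards [hmax] with y h1
  linarith

/-- A local test function can be replaced by a global one. -/
theorem exists_global_test {S : Set E} {u : E → ℝ} {x p : E} {C : ℝ} (hC : ∀ y ∈ S, u y ≤ C)
    (hp : p ∈ superdiff S u x) :
    ∃ φ : E → ℝ, ContDiff ℝ 1 φ ∧ gradient φ x = p ∧ IsMaxOn (fun y => u y - φ y) S x := by
  obtain ⟨φ, hφ, hmax⟩ := hp
  obtain ⟨r, hr, hr'⟩ := exists_closedBall_of_eventually_within hmax
  obtain ⟨s, hs, hs'⟩ := exists_closedBall_of_eventually hφ.eventually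
  set t := min r s with ht
  have ht0 : 0 < t := lt_min hr hs
  let η : ContDiffBump x := ⟨t / 3, t / 2, by positivity, by linarith⟩
  set m := u x - φ x with hm
  -- Where η is nonzero, u - φ ≤ m; everywhere on S, u - (C - m) ≤ m because u ≤ C. The convex
  -- combination therefore keeps the maximal value m at x.
  let ψ : E → ℝ := fun y => η y * φ y + (1 - η y) * (C - m)
  have hη : ∀ y, t / 2 ≤ dist y x → η y = 0 := fun y hy => η.zero_of_le_dist hy
  have hψx : ψ =ᶠ[𝓝 x] φ := by
    filter_upwards [η.eventuallyEq_one] with y hy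
    simp only [ψ, hy, Pi.one_apply]
    ring
  refine ⟨ψ, ?_, (hφ.congr hψx).gradient_eq, ?_⟩
  · rw [contDiff_iff_contDiffAt]
    intro y
    have hηy : ContDiffAt ℝ 1 η y := η.contDiffAt
    by_cases hy : dist y x < t
    · have h1 : ContDiffAt ℝ 1 φ y :=
        (hs' y (Metric.mem_closedBall.2 (hy.le.trans (min_le_right _ _)))).contDiffAt
      exact (hηy.mul h1).add ((contDiffAt_const.sub hηy).mul contDiffAt_const)
    · have : ψ =ᶠ[𝓝 y] fun _ => C - m := by
        have h2 : {w | t / 2 < dist w x} ∈ 𝓝 y :=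
          (isOpen_lt continuous_const (continuous_id.dist continuous_const)).mem_nhds
            (by simp only [mem_ofPred_eq, id]; linarith)
        filter_upwards [h2] with w hw
        simp [ψ, hη w (le_of_lt hw)]
      exact contDiffAt_const.congr_of_eventuallyEq this
  · intro y hy
    have hx1 : ψ x = φ x := hψx.eq_of_nhds
    simp only [mem_ofPred_eq, hx1, ← hm]
    by_cases hy' : dist y x < t
    · have h1 : u y - φ y ≤ m := hr' y ⟨hy, hy'.le.trans (min_le_left _ _)⟩
      have h2 := η.nonneg (x := y)
      have h3 := η.le_one (x := y)
      have h4 := hC y hy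
      simp only [ψ]
      nlinarith
    · have h1 := hη y (by linarith)
      have h4 := hC y hy
      simp only [ψ, h1]
      linarith

/-- Stability of superdifferentials under perturbations of the function. -/
theorem exists_superdiff_near {S : Set E} (hS : IsClosed S) {u : E → ℝ} {z p : E} (hz : z ∈ S)
    (hp : p ∈ superdiff S u z) {δ : ℝ} (hδ : 0 < δ) :
    ∃ η > 0, ∀ v : E → ℝ, ContinuousOn v S → (∀ x ∈ S, v x ≤ u x + η) → u z - η ≤ v z →
      ∃ x ∈ S, dist x z < δ ∧ ∃ q ∈ superdiff S v x, ‖q - p‖ < δ := by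
  obtain ⟨φ, hφ, hmax⟩ := hp
  have hgr : ∀ᶠ x in 𝓝 z, ‖gradient φ x + (2 : ℝ) • (x - z) - p‖ < δ := by
    have h1 : ContinuousAt (fun x => ‖gradient φ x + (2 : ℝ) • (x - z) - p‖) z :=
      ((hφ.continuousAt_gradient.add (by fun_prop)).sub continuousAt_const).norm
    refine h1.eventually_lt continuousAt_const ?_
    simpa [hφ.gradient_eq] using hδ
  obtain ⟨r1, hr1, h1⟩ := exists_closedBall_of_eventually_within hmax
  obtain ⟨r2, hr2, h2⟩ := exists_closedBall_of_eventually (hφ.eventually.and hgr)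
  set r := min (min r1 r2) (δ / 2) with hr
  have hr0 : 0 < r := lt_min (lt_min hr1 hr2) (by linarith)
  have hrr1 : r ≤ r1 := (min_le_left _ _).trans (min_le_left _ _)
  have hrr2 : r ≤ r2 := (min_le_left _ _).trans (min_le_right _ _)
  have hrd : r ≤ δ / 2 := min_le_right _ _
  -- A maximum point x of v - φ - ‖· - z‖² in the ball satisfies ‖x - z‖² ≤ 2η = 2r²/3 < r², so it
  -- is interior to the ball.
  refine ⟨r ^ 2 / 3, by positivity, fun v hv hvu hvz => ?_⟩
  have hc : IsCompact (S ∩ Metric.closedBall z r) := (isCompact_closedBall z r).inter_left hS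
  have hcont : ContinuousOn (fun x => v x - (φ x + ‖x - z‖ ^ 2)) (S ∩ Metric.closedBall z r) := by
    refine (hv.mono inter_subset_left).sub (ContinuousOn.add (fun x hx => ?_) (by fun_prop))
    exact (h2 x (Metric.closedBall_subset_closedBall hrr2 hx.2)).1.continuousAt.continuousWithinAt
  obtain ⟨x, hx, hxm⟩ := hc.exists_isMaxOn ⟨z, hz, Metric.mem_closedBall_self hr0.le⟩ hcont
  have e1 : v z - (φ z + ‖z - z‖ ^ 2) ≤ v x - (φ x + ‖x - z‖ ^ 2) :=
    hxm ⟨hz, Metric.mem_closedBall_self hr0.le⟩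
  have e2 : u x - φ x ≤ u z - φ z := h1 x ⟨hx.1, Metric.closedBall_subset_closedBall hrr1 hx.2⟩
  have e3 := hvu x hx.1
  have hxz : dist x z < r := by
    rw [dist_eq_norm]
    simp only [sub_self, norm_zero] at e1
    by_contra hcon
    push Not at hcon
    nlinarith
  have h2x := h2 x (Metric.closedBall_subset_closedBall hrr2 hx.2)
  exact ⟨x, hx.1, by linarith, _, ⟨_, h2x.1.add (C1At.norm_sub_sq z x),
    isLocalMaxOn_of_inter_closedBall hxz hxm⟩, h2x.2⟩

/-- A superdifferential of the half-sum of two Lipschitz functions is approximated by half-sums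
of superdifferentials. -/
theorem exists_superdiff_half_add {S : Set E} (hS : IsClosed S) {u v : E → ℝ} {z p : E}
    (hz : z ∈ S) {K R : ℝ} (hR : 0 < R)
    (hu : ∀ x ∈ S ∩ Metric.closedBall z R, ∀ y ∈ S ∩ Metric.closedBall z R,
      u x - u y ≤ K * ‖x - y‖)
    (hv : ∀ x ∈ S ∩ Metric.closedBall z R, ∀ y ∈ S ∩ Metric.closedBall z R,
      v x - v y ≤ K * ‖x - y‖)
    (huc : ContinuousOn u S) (hvc : ContinuousOn v S)
    (hp : p ∈ superdiff S (fun x => (u x + v x) / 2) z) :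
    ∃ C, ∀ δ > 0, ∃ x ∈ S, ∃ y ∈ S, dist x z < δ ∧ dist y z < δ ∧ ∃ q ∈ superdiff S u x,
      ∃ q' ∈ superdiff S v y, ‖q‖ ≤ C ∧ ‖q'‖ ≤ C ∧ ‖(1 / 2 : ℝ) • (q + q') - p‖ < δ := by
  obtain ⟨φ, hφ, hmax⟩ := hp
  have hgr : ∀ᶠ x in 𝓝 z, ‖gradient φ x‖ < ‖p‖ + 1 := by
    refine hφ.continuousAt_gradient.norm.eventually_lt continuousAt_const ?_
    simp [hφ.gradient_eq]
  obtain ⟨L, hL0, r3, hr3, h3⟩ := hφ.exists_lipschitz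
  obtain ⟨r1, hr1, h1⟩ := exists_closedBall_of_eventually_within hmax
  obtain ⟨r2, hr2, h2⟩ := exists_closedBall_of_eventually (hφ.eventually.and hgr)
  obtain ⟨r, hr0, hrr1, hrr2, hrr3, hrR⟩ : ∃ r > 0, r ≤ r1 ∧ r ≤ r2 ∧ r ≤ r3 ∧ r ≤ R :=
    ⟨min (min r1 r2) (min r3 R), lt_min (lt_min hr1 hr2) (lt_min hr3 hR),
      (min_le_left _ _).trans (min_le_left _ _), (min_le_left _ _).trans (min_le_right _ _),
      (min_le_right _ _).trans (min_le_left _ _), (min_le_right _ _).trans (min_le_right _ _)⟩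
  have hzr : z ∈ S ∩ Metric.closedBall z r := ⟨hz, Metric.mem_closedBall_self hr0.le⟩
  have hsub : ∀ {s}, r ≤ s → ∀ x ∈ S ∩ Metric.closedBall z r, x ∈ S ∩ Metric.closedBall z s :=
    fun hs x hx => ⟨hx.1, Metric.closedBall_subset_closedBall hs hx.2⟩
  -- Bound for N‖x - y‖ at the maximum below, from comparison with the pair (y, y): u contributes
  -- |K|/2, φ contributes L, the quadratic term 2r. It does not depend on N, which keeps the two
  -- gradients bounded as N grows.
  set A := |K| / 2 + L + 2 * r with hA
  have hA0 : 0 < A := by positivity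
  refine ⟨2 * (‖p‖ + 1 + 2 * r + 2 * A) + 4 * A, fun δ hδ => ?_⟩
  have hgr2 : ∀ᶠ x in 𝓝 z, ‖gradient φ x + (2 : ℝ) • (x - z) - p‖ < δ := by
    have h1 : ContinuousAt (fun x => ‖gradient φ x + (2 : ℝ) • (x - z) - p‖) z :=
      ((hφ.continuousAt_gradient.add (by fun_prop)).sub continuousAt_const).norm
    refine h1.eventually_lt continuousAt_const ?_
    simpa [hφ.gradient_eq] using hδ
  obtain ⟨r4, hr4, h4⟩ := exists_closedBall_of_eventually hgr2
  obtain ⟨s, hs0, hsr, hsδ, hsr4⟩ : ∃ s > 0, s ≤ r / 2 ∧ s ≤ δ / 3 ∧ s ≤ r4 / 2 :=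
    ⟨min (r / 2) (min (δ / 3) (r4 / 2)), by positivity, min_le_left _ _,
      (min_le_right _ _).trans (min_le_left _ _), (min_le_right _ _).trans (min_le_right _ _)⟩
  obtain ⟨N, hN0, hN1, hN2⟩ : ∃ N > 0, A / N < s ∧ |K| * (A / N) < s ^ 2 := by
    have ht : Tendsto (fun N : ℝ => A / N) atTop (𝓝 0) := tendsto_const_nhds.div_atTop tendsto_id
    have ht2 : Tendsto (fun N : ℝ => |K| * (A / N)) atTop (𝓝 0) := by simpa using ht.const_mul |K|
    obtain ⟨N, hN⟩ := ((eventually_gt_atTop 0).and ((ht.eventually_lt_const hs0).and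
      (ht2.eventually_lt_const (by positivity : 0 < s ^ 2)))).exists
    exact ⟨N, hN⟩
  have hc : IsCompact ((S ∩ Metric.closedBall z r) ×ˢ (S ∩ Metric.closedBall z r)) :=
    ((isCompact_closedBall z r).inter_left hS).prod ((isCompact_closedBall z r).inter_left hS)
  have hφc : ContinuousOn φ (S ∩ Metric.closedBall z r) := fun x hx =>
    (h2 x (hsub hrr2 x hx).2).1.continuousAt.continuousWithinAt
  have hcont : ContinuousOn (fun w : E × E => (u w.1 + v w.2) / 2 - φ w.1 - ‖w.1 - z‖ ^ 2
      - N * ‖w.1 - w.2‖ ^ 2) ((S ∩ Metric.closedBall z r) ×ˢ (S ∩ Metric.closedBall z r)) := by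
    have a1 := (huc.mono inter_subset_left).comp (t := S ∩ Metric.closedBall z r)
      (s := (S ∩ Metric.closedBall z r) ×ˢ (S ∩ Metric.closedBall z r)) continuousOn_fst
      fun w hw => hw.1
    have a2 := (hvc.mono inter_subset_left).comp (t := S ∩ Metric.closedBall z r)
      (s := (S ∩ Metric.closedBall z r) ×ˢ (S ∩ Metric.closedBall z r)) continuousOn_snd
      fun w hw => hw.2
    have a3 := hφc.comp (t := S ∩ Metric.closedBall z r)
      (s := (S ∩ Metric.closedBall z r) ×ˢ (S ∩ Metric.closedBall z r)) continuousOn_fst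
      fun w hw => hw.1
    exact ((((a1.add a2).div_const 2).sub a3).sub (by fun_prop)).sub (by fun_prop)
  -- Doubling of variables: the maximum in x alone and in y alone gives superdifferentials of u and
  -- v. The terms in N(x - y) cancel in their half-sum, leaving ∇φ(x) + 2(x - z), which is close to
  -- p.
  obtain ⟨⟨x, y⟩, ⟨hx, hy⟩, hxy⟩ := hc.exists_isMaxOn ⟨(z, z), hzr, hzr⟩ hcont
  simp only at hx hy
  have hmx : ∀ x' ∈ S ∩ Metric.closedBall z r, ∀ y' ∈ S ∩ Metric.closedBall z r,
      (u x' + v y') / 2 - φ x' - ‖x' - z‖ ^ 2 - N * ‖x' - y'‖ ^ 2 ≤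
        (u x + v y) / 2 - φ x - ‖x - z‖ ^ 2 - N * ‖x - y‖ ^ 2 := fun x' hx' y' hy' =>
    hxy (show (x', y') ∈ _ from ⟨hx', hy'⟩)
  have hd1 : N * ‖x - y‖ ≤ A := by
    have e := hmx y hy y hy
    have e1 := hu x (hsub hrR x hx) y (hsub hrR y hy)
    have e2 := (abs_le.1 (h3 x (hsub hrr3 x hx).2 y (hsub hrr3 y hy).2)).1
    have e3 : ‖y - z‖ ≤ ‖x - z‖ + ‖x - y‖ := by
      have := norm_sub_le (x - z) (x - y)
      simpa using this
    have e4 : ‖y - z‖ ≤ r := by simpa [dist_eq_norm] using hy.2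
    have e5 : ‖x - z‖ ≤ r := by simpa [dist_eq_norm] using hx.2
    have e6 : K * ‖x - y‖ ≤ |K| * ‖x - y‖ :=
      mul_le_mul_of_nonneg_right (le_abs_self K) (norm_nonneg _)
    simp only [sub_self, norm_zero] at e
    have e7 : ‖y - z‖ ^ 2 - ‖x - z‖ ^ 2 ≤ 2 * r * ‖x - y‖ := by
      have := norm_nonneg (y - z)
      have := norm_nonneg (x - z)
      have := norm_nonneg (x - y)
      nlinarith
    have e8 : N * ‖x - y‖ * ‖x - y‖ ≤ A * ‖x - y‖ := by
      rw [hA]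
      nlinarith
    rcases (norm_nonneg (x - y)).eq_or_lt' with h0 | h0
    · rw [h0, mul_zero]
      exact hA0.le
    · exact le_of_mul_le_mul_right e8 h0
  have hd2 : ‖x - y‖ ≤ A / N := by
    rw [le_div_iff₀ hN0]
    linarith
  -- Comparison with (z, z): replacing v(y) by v(x) costs at most |K|A/N, and z is a local maximum
  -- of the undoubled function.
  have hd3 : ‖x - z‖ < s := by
    have e := hmx z hzr z hzr
    have e1 := hv y (hsub hrR y hy) x (hsub hrR x hx)
    have e2 : (u x + v x) / 2 - φ x ≤ (u z + v z) / 2 - φ z := h1 x (hsub hrr1 x hx)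
    have e3 : K * ‖y - x‖ ≤ |K| * (A / N) := by
      rw [norm_sub_rev]
      exact (mul_le_mul_of_nonneg_right (le_abs_self K) (norm_nonneg _)).trans
        (mul_le_mul_of_nonneg_left hd2 (abs_nonneg _))
    simp only [sub_self, norm_zero] at e
    have e4 : 0 ≤ N * ‖x - y‖ ^ 2 := by positivity
    have e5 : 0 ≤ |K| * (A / N) := by positivity
    exact lt_of_pow_lt_pow_left₀ 2 hs0.le (by nlinarith)
  have hd4 : ‖y - z‖ < 2 * s := by
    have := norm_sub_le (x - z) (x - y)
    have : ‖y - z‖ ≤ ‖x - z‖ + ‖x - y‖ := by simpa using this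
    linarith
  have h2x := h2 x (hsub hrr2 x hx).2
  refine ⟨x, hx.1, y, hy.1, by rw [dist_eq_norm]; linarith, by rw [dist_eq_norm]; linarith,
    (2 : ℝ) • (gradient φ x + (2 : ℝ) • (x - z) + N • (2 : ℝ) • (x - y)), ⟨_,
      ((h2x.1.add (C1At.norm_sub_sq z x)).add ((C1At.norm_sub_sq y x).const_mul N)).const_mul 2,
      isLocalMaxOn_of_inter_closedBall (z := z) (r := r) (by rw [dist_eq_norm]; linarith)
      fun x' hx' => ?_⟩,
    (2 : ℝ) • N • (2 : ℝ) • (y - x), ⟨_, ((C1At.norm_sub_sq x y).const_mul N).const_mul 2,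
      isLocalMaxOn_of_inter_closedBall (z := z) (r := r) (by rw [dist_eq_norm]; linarith)
      fun y' hy' => ?_⟩, ?_, ?_, ?_⟩
  · have := hmx x' hx' y hy
    linarith
  · have := hmx x hx y' hy'
    rw [norm_sub_rev x y', norm_sub_rev x y] at this
    linarith
  · have e1 : ‖N • (2 : ℝ) • (x - y)‖ = 2 * (N * ‖x - y‖) := by
      rw [norm_smul, norm_smul, Real.norm_of_nonneg hN0.le, Real.norm_of_nonneg zero_le_two]
      ring
    have e2 : ‖(2 : ℝ) • (x - z)‖ = 2 * ‖x - z‖ := by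
      rw [norm_smul, Real.norm_of_nonneg zero_le_two]
    rw [norm_smul, Real.norm_of_nonneg zero_le_two]
    have e3 := norm_add₃_le (a := gradient φ x) (b := (2 : ℝ) • (x - z))
      (c := N • (2 : ℝ) • (x - y))
    have := h2x.2
    linarith
  · rw [norm_smul, norm_smul, norm_smul, Real.norm_of_nonneg hN0.le,
      Real.norm_of_nonneg zero_le_two, norm_sub_rev]
    have := norm_nonneg p
    linarith
  · have : (1 / 2 : ℝ) • ((2 : ℝ) • (gradient φ x + (2 : ℝ) • (x - z) + N • (2 : ℝ) • (x - y)) +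
        (2 : ℝ) • N • (2 : ℝ) • (y - x)) = gradient φ x + (2 : ℝ) • (x - z) := by
      module
    rw [this]
    exact h4 x (by rw [mem_closedBall_iff_norm]; linarith)

end Superdifferential


theorem mem_or_mem_frontier {X : Type*} [TopologicalSpace X] {Ω : Set X} {x : X}
    (hx : x ∈ closure Ω) : x ∈ Ω ∨ x ∈ frontier Ω := by
  by_cases h : x ∈ Ω
  · exact Or.inl h
  · exact Or.inr ⟨hx, fun h' => h (interior_subset h')⟩

/-! ### The Neumann problem, boundary charts and coercivity -/

section Problem

variable {E : Type*} [NormedAddCommGroup E] [InnerProductSpace ℝ E] [FiniteDimensional ℝ E]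

/-- `ρ` is a `C¹` defining function of `Ω` near `z`. -/
structure IsChart (Ω : Set E) (ρ : E → ℝ) (z : E) : Prop where
  c1At : C1At ρ (gradient ρ z) z
  gradient_ne_zero : gradient ρ z ≠ 0
  mem_iff : ∀ᶠ x in 𝓝 z, (x ∈ Ω ↔ ρ x < 0)

/-- The standing assumptions on the data of the Neumann problem. -/
structure NeumannProblem (Ω : Set E) (H : E → E → ℝ) (γ : E → E) (g : E → ℝ) : Prop where
  isOpen : IsOpen Ω
  isBounded : Bornology.IsBounded Ω
  isConnected : IsConnected Ω
  chart : ∀ z ∈ frontier Ω, ∃ ρ, IsChart Ω ρ z ∧ 0 < inner ℝ (gradient ρ z) (γ z)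
  continuousOn_H : ContinuousOn (fun q : E × E => H q.1 q.2) (closure Ω ×ˢ univ)
  convexOn_H : ∀ x ∈ closure Ω, ConvexOn ℝ univ (H x)
  coercive_H : ∀ x ∈ closure Ω, Tendsto (H x) (Bornology.cobounded E) atTop
  continuousOn_γ : ContinuousOn γ (frontier Ω)
  continuousOn_g : ContinuousOn g (frontier Ω)

/-- Continuity of ρ suffices except for the last implication. There the nonzero gradient enters:
from a zero of ρ, small moves along -∇ρ(z) make ρ negative, so the zero is a limit of points of Ω.
-/
theorem IsChart.eventually {Ω : Set E} {ρ : E → ℝ} {z : E} (h : IsChart Ω ρ z) :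
    ∀ᶠ x in 𝓝 z, C1At ρ (gradient ρ x) x ∧ (x ∈ Ω ↔ ρ x < 0) ∧ (x ∈ closure Ω → ρ x ≤ 0) ∧
      (x ∈ frontier Ω → ρ x = 0) ∧ (ρ x = 0 → x ∈ frontier Ω) := by
  have hn : 0 < ‖gradient ρ z‖ := norm_pos_iff.2 h.gradient_ne_zero
  obtain ⟨r, hr, hr'⟩ := h.c1At.strict_expansion (half_pos hn)
  have hball : ∀ᶠ x in 𝓝 z, Metric.closedBall z r ∈ 𝓝 x :=
    eventually_eventually_nhds.2 (Metric.closedBall_mem_nhds z hr)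
  filter_upwards [h.c1At.eventually, eventually_eventually_nhds.2 h.mem_iff, hball]
    with x hx hx' hxr
  have hle : x ∈ closure Ω → ρ x ≤ 0 := by
    intro hxc
    by_contra hcon
    push Not at hcon
    have h1 := hx.continuousAt.eventually_const_lt hcon
    obtain ⟨y, hy1, hy2, hy3⟩ := ((mem_closure_iff_frequently.1 hxc).and_eventually
      (hx'.and h1)).exists
    linarith [hy2.1 hy1]
  refine ⟨hx, hx'.self_of_nhds, hle, fun hxf => ?_, fun h0 => ?_⟩
  · refine le_antisymm (hle hxf.1) ?_
    by_contra hcon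
    push Not at hcon
    have h1 : ∀ᶠ y in 𝓝 x, y ∈ Ω := by
      filter_upwards [hx', hx.continuousAt.eventually_lt_const hcon] with y h1 h2
      exact h1.2 h2
    exact hxf.2 (mem_interior_iff_mem_nhds.2 h1)
  · have hnot : x ∉ interior Ω := fun hmem => by
      have := hx'.self_of_nhds.1 (interior_subset hmem)
      linarith
    refine ⟨?_, hnot⟩
    have ht : Tendsto (fun t : ℝ => x - t • gradient ρ z) (𝓝[>] 0) (𝓝 x) := by
      have : Tendsto (fun t : ℝ => x - t • gradient ρ z) (𝓝 0) (𝓝 (x - (0 : ℝ) • gradient ρ z)) :=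
        Continuous.tendsto (by fun_prop) 0
      simpa using this.mono_left nhdsWithin_le_nhds
    refine mem_closure_of_tendsto ht ?_
    filter_upwards [ht.eventually hx', ht.eventually hxr, self_mem_nhdsWithin] with t h1 h2 h3
    refine h1.2 ?_
    have h4 := (abs_le.1 (hr' _ h2 x (mem_of_mem_nhds hxr))).2
    have h3' : (0 : ℝ) < t := h3
    have e1 : x - t • gradient ρ z - x = -(t • gradient ρ z) := by abel
    rw [e1, inner_neg_right, inner_smul_right, real_inner_self_eq_norm_sq, norm_neg, norm_smul,
      Real.norm_of_nonneg h3'.le, h0] at h4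
    have : 0 < t * ‖gradient ρ z‖ ^ 2 := by positivity
    nlinarith

/-- The conditions on the superdifferential of a subsolution at the level `a`, at `x`. -/
def SubAt (Ω : Set E) (H : E → E → ℝ) (γ : E → E) (g : E → ℝ) (a : ℝ) (u : E → ℝ) (x : E) :
    Prop :=
  ∀ p ∈ superdiff (closure Ω) u x, (x ∈ Ω → H x p ≤ a) ∧
    (x ∈ frontier Ω → H x p ≤ a ∨ inner ℝ (γ x) p ≤ g x)

namespace NeumannProblem

variable {Ω : Set E} {H : E → E → ℝ} {γ : E → E} {g : E → ℝ}

theorem isCompact_closure (P : NeumannProblem Ω H γ g) : IsCompact (closure Ω) :=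
  P.isBounded.isCompact_closure

theorem isCompact_frontier (P : NeumannProblem Ω H γ g) : IsCompact (frontier Ω) :=
  P.isCompact_closure.of_isClosed_subset isClosed_frontier frontier_subset_closure

theorem notMem_frontier (P : NeumannProblem Ω H γ g) {x : E} (hx : x ∈ Ω) : x ∉ frontier Ω :=
  fun h => h.2 (P.isOpen.interior_eq.symm ▸ hx)

theorem tendsto_H (P : NeumannProblem Ω H γ g) {ι : Type*} {l : Filter ι} {x p : ι → E}
    {x₀ p₀ : E} (hx₀ : x₀ ∈ closure Ω) (hx : ∀ᶠ i in l, x i ∈ closure Ω)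
    (hxt : Tendsto x l (𝓝 x₀)) (hpt : Tendsto p l (𝓝 p₀)) :
    Tendsto (fun i => H (x i) (p i)) l (𝓝 (H x₀ p₀)) := by
  have h1 := P.continuousOn_H (x₀, p₀) ⟨hx₀, mem_univ _⟩
  refine h1.tendsto.comp (tendsto_nhdsWithin_iff.2 ⟨hxt.prodMk_nhds hpt, ?_⟩)
  filter_upwards [hx] with i hi using ⟨hi, mem_univ _⟩

/-- Coercivity of the Hamiltonian is uniform. -/
theorem exists_norm_le (P : NeumannProblem Ω H γ g) (a : ℝ) :
    ∃ M, ∀ x ∈ closure Ω, ∀ p, H x p ≤ a → ‖p‖ ≤ M := by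
  by_contra! hcon
  choose x hx p hp hn using fun k : ℕ => hcon (k : ℝ)
  obtain ⟨x₀, hx₀, θ, hθ, hxt⟩ := P.isCompact_closure.tendsto_subseq hx
  have hpos : ∀ k, 0 < ‖p k‖ := fun k => (Nat.cast_nonneg k).trans_lt (hn k)
  obtain ⟨e, -, θ', hθ', het⟩ := (isCompact_closedBall (0 : E) 1).tendsto_subseq
    (x := fun k => ‖p (θ k)‖⁻¹ • p (θ k)) fun k => by
      rw [mem_closedBall_zero_iff, norm_smul, norm_inv, norm_norm,
        inv_mul_cancel₀ (hpos _).ne']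
  have hex : ∃ R : ℝ, 0 < R ∧ ∀ q : E, R ≤ ‖q‖ → max a (H x₀ 0 + 1) < H x₀ q := by
    have h1 := (P.coercive_H x₀ hx₀).eventually_gt_atTop (max a (H x₀ 0 + 1))
    rw [← comap_norm_atTop, eventually_comap] at h1
    obtain ⟨R, hR⟩ := eventually_atTop.1 h1
    exact ⟨max R 1, by positivity, fun q hq => hR ‖q‖ ((le_max_left _ _).trans hq) q rfl⟩
  obtain ⟨R, hR0, hR⟩ := hex
  have hxt' : Tendsto (fun k => x (θ (θ' k))) atTop (𝓝 x₀) := hxt.comp hθ'.tendsto_atTop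
  have hen : ‖e‖ = 1 := by
    refine tendsto_nhds_unique het.norm ?_
    refine tendsto_const_nhds.congr fun k => ?_
    simp only [Function.comp]
    rw [norm_smul, norm_inv, norm_norm, inv_mul_cancel₀ (hpos _).ne']
  have hlim : Tendsto (fun k => H (x (θ (θ' k))) (R • ‖p (θ (θ' k))‖⁻¹ • p (θ (θ' k)))) atTop
      (𝓝 (H x₀ (R • e))) :=
    P.tendsto_H hx₀ (Eventually.of_forall fun k => hx _) hxt' (het.const_smul R)
  have hlim0 : Tendsto (fun k => H (x (θ (θ' k))) 0) atTop (𝓝 (H x₀ 0)) :=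
    P.tendsto_H hx₀ (Eventually.of_forall fun k => hx _) hxt' tendsto_const_nhds
  have hlt : max a (H x₀ 0 + 1) < H x₀ (R • e) := hR _ (by
    rw [norm_smul, hen, mul_one, Real.norm_of_nonneg hR0.le])
  have hθθ : Tendsto (fun k => θ (θ' k)) atTop atTop := hθ.tendsto_atTop.comp hθ'.tendsto_atTop
  obtain ⟨k, h1, h2, h3⟩ := ((hlim.eventually_const_lt hlt).and
    ((hlim0.eventually_lt_const (lt_add_one _)).and
      ((tendsto_natCast_atTop_atTop (R := ℝ)).comp hθθ |>.eventually_ge_atTop R))).exists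
  simp only [Function.comp] at h3
  set j := θ (θ' k)
  have hRj : R ≤ ‖p j‖ := h3.trans (hn j).le
  have hb0 : 0 ≤ R * ‖p j‖⁻¹ := by positivity
  have hb1 : R * ‖p j‖⁻¹ ≤ 1 := by
    rw [← div_eq_mul_inv]; exact div_le_one_of_le₀ hRj (norm_nonneg _)
  -- The point of norm R on the segment from 0 to p_j has H at most a convex combination of H(x_j,
  -- 0) and a; in the limit direction e this contradicts the large value of H(x₀, R e).
  have hcv := (P.convexOn_H (x j) (hx j)).2 (mem_univ 0) (mem_univ (p j))
    (sub_nonneg.2 hb1) hb0 (sub_add_cancel 1 _)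
  rw [smul_zero, zero_add, mul_smul, smul_eq_mul, smul_eq_mul] at hcv
  have hp' := hp j
  have m1 := le_max_left a (H x₀ 0 + 1)
  have m2 := le_max_right a (H x₀ 0 + 1)
  nlinarith

end NeumannProblem

/-! ### Oblique barriers and the local Lipschitz estimate -/

theorem c1At_norm_comp (T : E →L[ℝ] E) {x y : E} (h : T (x - y) ≠ 0) :
    ∃ p, C1At (fun w => ‖T (w - y)‖) p x ∧
      ∀ w, inner ℝ p w = inner ℝ (T (x - y)) (T w) / ‖T (x - y)‖ := by
  have hd : HasFDerivAt (fun w => T (w - y)) T x :=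
    T.hasFDerivAt.comp x ((hasFDerivAt_id x).sub_const y)
  have hn : ‖T (x - y)‖ ^ 2 ≠ 0 := by simpa using h
  have h1 := hd.norm_sq
  have h2 := (Real.hasDerivAt_sqrt hn).comp_hasFDerivAt x h1
  have he : (fun w => ‖T (w - y)‖) = Real.sqrt ∘ fun w => ‖T (w - y)‖ ^ 2 := by
    ext w
    simp [Real.sqrt_sq]
  rw [← he] at h2
  set L := (1 / (2 * √(‖T (x - y)‖ ^ 2))) • 2 • innerSL ℝ (T (x - y)) ∘SL T with hL
  refine ⟨(InnerProductSpace.toDual ℝ E).symm L, C1At.of_hasFDerivAt ?_ h2 fun w => ?_, fun w => ?_⟩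
  · exact ContDiffAt.norm ℝ (by fun_prop) h
  · rw [InnerProductSpace.toDual_symm_apply]
  · rw [InnerProductSpace.toDual_symm_apply]
    simp [hL, Real.sqrt_sq, inner_sub_left]
    field_simp

/-- A family of functions `d y`, comparable to the distance to `y`, whose gradients away from `y`
are bounded below, and which are increasing in the direction `γ` on the boundary. -/
theorem NeumannProblem.exists_barrier {Ω : Set E} {H : E → E → ℝ} {γ : E → E} {g : E → ℝ}
    (P : NeumannProblem Ω H γ g) {z : E} (hz : z ∈ closure Ω) :
    ∃ R > 0, ∃ m > 0, ∃ C, ∃ d : E → E → ℝ, ∀ y ∈ closure Ω ∩ Metric.closedBall z R,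
      d y y = 0 ∧ ContinuousOn (d y) (Metric.closedBall z R) ∧
      ∀ x ∈ closure Ω ∩ Metric.closedBall z R, m * ‖x - y‖ ≤ d y x ∧ d y x ≤ C * ‖x - y‖ ∧
        (x ≠ y → ∃ p, C1At (d y) p x ∧ m ≤ ‖p‖ ∧ (x ∈ frontier Ω → m ≤ inner ℝ (γ x) p)) := by
  rcases mem_or_mem_frontier hz with hzΩ | hzf
  · obtain ⟨R, hR, hR'⟩ := exists_closedBall_of_eventually (P.isOpen.mem_nhds hzΩ)
    refine ⟨R, hR, 1, one_pos, 1, fun y x => ‖x - y‖, fun y hy => ⟨by simp, by fun_prop,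
      fun x hx => ⟨by simp, by simp, fun hxy => ?_⟩⟩⟩
    have hne : x - y ≠ 0 := sub_ne_zero.2 hxy
    obtain ⟨p, hp, hp'⟩ := c1At_norm_comp (ContinuousLinearMap.id ℝ E) (x := x) (y := y) hne
    refine ⟨p, hp, ?_, fun hxf => absurd hxf (P.notMem_frontier (hR' x hx.2))⟩
    have h1 := hp' (x - y)
    simp only [ContinuousLinearMap.id_apply, real_inner_self_eq_norm_sq] at h1
    have h2 := real_inner_le_norm p (x - y)
    have h3 : 0 < ‖x - y‖ := norm_pos_iff.2 hne
    rw [h1, pow_two, mul_div_assoc, div_self h3.ne', mul_one] at h2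
    exact le_of_mul_le_mul_right (by linarith) h3
  · obtain ⟨ρ, hρ, hκ⟩ := P.chart z hzf
    set n := gradient ρ z with hn
    set κ := inner ℝ n (γ z) with hκdef
    have hn0 : 0 < ‖n‖ := norm_pos_iff.2 hρ.gradient_ne_zero
    -- T fixes the hyperplane orthogonal to n and sends γ(z) to n. Along γ(z) the derivative of ‖T(x
    -- - y)‖ is then a positive multiple of n·(x - y), which is nearly nonnegative for x on the
    -- boundary and y in the closure. The added term θ(ρ(x) - ρ(y)) makes the derivative strictly
    -- positive.
    let T : E →L[ℝ] E :=
      ContinuousLinearMap.id ℝ E + (innerSL ℝ n).smulRight (κ⁻¹ • (n - γ z))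
    have hT : ∀ w, T w = w + (inner ℝ n w * κ⁻¹) • (n - γ z) := fun w => by
      simp [T, smul_smul]
    have hTγ : T (γ z) = n := by
      rw [hT, ← hκdef, mul_inv_cancel₀ hκ.ne', one_smul]
      abel
    have hTn : ∀ w, inner ℝ (T w) n = inner ℝ n w * (‖n‖ ^ 2 / κ) := fun w => by
      rw [hT, inner_add_left, inner_smul_left, inner_sub_left, real_inner_self_eq_norm_sq,
        real_inner_comm n (γ z), ← hκdef, real_inner_comm n w]
      simp only [conj_trivial]
      field_simp
      ring
    have hker : LinearMap.ker T.toLinearMap = ⊥ := by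
      rw [LinearMap.ker_eq_bot']
      intro w hw
      have hw' : T w = 0 := hw
      have h1 := hTn w
      rw [hw', inner_zero_left] at h1
      have h2 : inner ℝ n w = 0 := by
        rcases mul_eq_zero.1 h1.symm with h | h
        · exact h
        · exact absurd h (by positivity)
      rw [hT, h2] at hw'
      simpa using hw'
    obtain ⟨K, hK0, hK⟩ := T.toLinearMap.exists_antilipschitzWith hker
    obtain ⟨c, hc0, hc⟩ : ∃ c > 0, ∀ w, c * ‖w‖ ≤ ‖T w‖ := by
      refine ⟨(K : ℝ)⁻¹, by positivity, fun w => ?_⟩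
      have h1 := hK.le_mul_dist w 0
      simp only [dist_eq_norm, sub_zero, map_zero] at h1
      rw [inv_mul_le_iff₀ (by positivity)]
      exact h1
    -- The ρ-term is Lipschitz with constant θ(‖n‖ + 1) = c/2, so it consumes at most half of the
    -- lower bound c‖x - y‖.
    set θ := c / (2 * (‖n‖ + 1)) with hθ
    have hθ0 : 0 < θ := by positivity
    have hθ1 : θ * (‖n‖ + 1) = c / 2 := by
      rw [hθ]
      field_simp
    -- ε₁ controls the linearization of ρ and ε₂ the oscillation of γ. Each costs at most θκ/8 in
    -- the derivative along γ, out of the gain θκ/2 from the ρ-term.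
    set ε₁ := min 1 (θ * κ ^ 2 * c / (8 * ‖n‖ ^ 2)) with hε₁
    have hε₁0 : 0 < ε₁ := by positivity
    set ε₂ := θ * κ / (8 * (‖T‖ + 1)) with hε₂
    have hε₂0 : 0 < ε₂ := by positivity
    have hgrad : ∀ᶠ x in 𝓝 z, ‖gradient ρ x‖ < ‖n‖ + 1 :=
      hρ.c1At.continuousAt_gradient.norm.eventually_lt_const (lt_add_one _)
    have hγt : Tendsto γ (𝓝[frontier Ω] z) (𝓝 (γ z)) := P.continuousOn_γ z hzf
    have hbd : ∀ᶠ x in 𝓝[frontier Ω] z, κ / 2 < inner ℝ (gradient ρ x) (γ x) ∧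
        ‖γ x - γ z‖ < ε₂ := by
      refine Eventually.and ?_ ?_
      · have h1 : Tendsto (fun x => inner ℝ (gradient ρ x) (γ x)) (𝓝[frontier Ω] z) (𝓝 κ) :=
          (hρ.c1At.continuousAt_gradient.tendsto.mono_left nhdsWithin_le_nhds).inner hγt
        exact h1.eventually_const_lt (half_lt_self hκ)
      · have h1 : Tendsto (fun x => ‖γ x - γ z‖) (𝓝[frontier Ω] z) (𝓝 0) := by
          simpa using (hγt.sub_const (γ z)).norm
        exact h1.eventually_lt_const hε₂0
    obtain ⟨r1, hr1, h1⟩ := exists_closedBall_of_eventually (hρ.eventually.and hgrad)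
    obtain ⟨r2, hr2, h2⟩ := exists_closedBall_of_eventually_within hbd
    obtain ⟨r3, hr3, h3⟩ := hρ.c1At.strict_expansion hε₁0
    obtain ⟨R, hR, hRr1, hRr2, hRr3⟩ : ∃ R > 0, R ≤ r1 ∧ R ≤ r2 ∧ R ≤ r3 :=
      ⟨min r1 (min r2 r3), by positivity, min_le_left _ _,
        (min_le_right _ _).trans (min_le_left _ _), (min_le_right _ _).trans (min_le_right _ _)⟩
    have hsub : ∀ {s}, R ≤ s → ∀ x ∈ Metric.closedBall z R, x ∈ Metric.closedBall z s :=
      fun hs x hx => Metric.closedBall_subset_closedBall hs hx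
    refine ⟨R, hR, min (c / 2) (θ * κ / 4), by positivity, ‖T‖ + c / 2,
      fun y x => ‖T (x - y)‖ + θ * (ρ x - ρ y), fun y hy => ⟨by simp, ?_, fun x hx => ?_⟩⟩
    · refine ContinuousOn.add (by fun_prop) (continuousOn_const.mul (ContinuousOn.sub
        (fun x hx => ?_) continuousOn_const))
      exact (h1 x (hsub hRr1 x hx)).1.1.continuousAt.continuousWithinAt
    obtain ⟨⟨hρx, -, -, hρf, -⟩, hgx⟩ := h1 x (hsub hRr1 x hx.2)
    obtain ⟨⟨-, -, hρy, -, -⟩, -⟩ := h1 y (hsub hRr1 y hy.2)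
    have hexp := abs_le.1 (h3 x (hsub hRr3 x hx.2) y (hsub hRr3 y hy.2))
    have hin := abs_le.1 (abs_real_inner_le_norm n (x - y))
    have hε1 : ε₁ * ‖x - y‖ ≤ ‖x - y‖ :=
      mul_le_of_le_one_left (norm_nonneg _) (min_le_left _ _)
    have hcT := hc (x - y)
    have hθρ1 : θ * (ρ x - ρ y) ≤ c / 2 * ‖x - y‖ := by
      rw [← hθ1, mul_assoc]
      exact mul_le_mul_of_nonneg_left (by linarith) hθ0.le
    have hθρ2 : -(c / 2 * ‖x - y‖) ≤ θ * (ρ x - ρ y) := by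
      rw [← hθ1, mul_assoc, ← mul_neg]
      exact mul_le_mul_of_nonneg_left (by linarith) hθ0.le
    refine ⟨?_, ?_, fun hxy => ?_⟩
    · have := mul_le_mul_of_nonneg_right (min_le_left (c / 2) (θ * κ / 4)) (norm_nonneg (x - y))
      simp only
      linarith
    · have := T.le_opNorm (x - y)
      simp only
      linarith
    have hxy0 : 0 < ‖x - y‖ := norm_pos_iff.2 (sub_ne_zero.2 hxy)
    have hTxy : 0 < ‖T (x - y)‖ := lt_of_lt_of_le (by positivity) hcT
    obtain ⟨p, hp, hp'⟩ := c1At_norm_comp T (norm_pos_iff.1 hTxy)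
    refine ⟨p + θ • gradient ρ x, hp.add
      (((hρx.add_const (-ρ y)).const_mul θ).congr (Eventually.of_forall fun w => by ring)),
      (min_le_left _ _).trans ?_, fun hxf => (min_le_right _ _).trans ?_⟩
    · have e1 := real_inner_le_norm (p + θ • gradient ρ x) (x - y)
      have e2 := (abs_le.1 (abs_real_inner_le_norm (gradient ρ x) (x - y))).1
      have e3 : inner ℝ p (x - y) = ‖T (x - y)‖ := by
        rw [hp', real_inner_self_eq_norm_sq]
        field_simp
      rw [inner_add_left, inner_smul_left, e3] at e1
      simp only [conj_trivial] at e1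
      have e4 : -(c / 2 * ‖x - y‖) ≤ θ * inner ℝ (gradient ρ x) (x - y) := by
        rw [← hθ1, mul_assoc, ← mul_neg]
        refine mul_le_mul_of_nonneg_left ?_ hθ0.le
        nlinarith
      exact le_of_mul_le_mul_right (by linarith) hxy0
    · obtain ⟨e1, e2⟩ := h2 x ⟨hxf, hsub hRr2 x hx.2⟩
      have e3 : T (γ x) = n + T (γ x - γ z) := by
        rw [map_sub, hTγ]
        abel
      have e4 := (abs_le.1 (abs_real_inner_le_norm (T (x - y)) (T (γ x - γ z)))).1
      have e5 : ‖T (γ x - γ z)‖ ≤ θ * κ / 8 := by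
        refine (T.le_opNorm _).trans ?_
        calc ‖T‖ * ‖γ x - γ z‖ ≤ (‖T‖ + 1) * ε₂ :=
              mul_le_mul (by linarith) e2.le (norm_nonneg _) (by positivity)
          _ = θ * κ / 8 := by rw [hε₂]; field_simp
      -- Here ρ(x) = 0 ≥ ρ(y): seen from a boundary point, the closure lies on the inner side up to
      -- first order.
      have e6 : -(ε₁ * ‖x - y‖) ≤ inner ℝ n (x - y) := by
        have := hρf hxf
        have := hρy hy.1
        linarith [hexp.2]
      have e7 : -(θ * κ / 8 * ‖T (x - y)‖) ≤ inner ℝ (T (x - y)) n := by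
        rw [hTn]
        have a1 : -(ε₁ * ‖x - y‖) * (‖n‖ ^ 2 / κ) ≤ inner ℝ n (x - y) * (‖n‖ ^ 2 / κ) :=
          mul_le_mul_of_nonneg_right e6 (by positivity)
        have a2 : ε₁ * ‖x - y‖ * (‖n‖ ^ 2 / κ) ≤
            θ * κ ^ 2 * c / (8 * ‖n‖ ^ 2) * ‖x - y‖ * (‖n‖ ^ 2 / κ) := by
          have := min_le_right 1 (θ * κ ^ 2 * c / (8 * ‖n‖ ^ 2))
          gcongr
        have a3 : θ * κ ^ 2 * c / (8 * ‖n‖ ^ 2) * ‖x - y‖ * (‖n‖ ^ 2 / κ) =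
            θ * κ / 8 * (c * ‖x - y‖) := by
          field_simp
        have a4 : θ * κ / 8 * (c * ‖x - y‖) ≤ θ * κ / 8 * ‖T (x - y)‖ :=
          mul_le_mul_of_nonneg_left hcT (by positivity)
        linarith
      rw [real_inner_comm, inner_add_left, inner_smul_left, hp', e3, inner_add_right]
      simp only [conj_trivial]
      have e8 : -(θ * κ / 4) ≤
          (inner ℝ (T (x - y)) n + inner ℝ (T (x - y)) (T (γ x - γ z))) / ‖T (x - y)‖ := by
        rw [le_div_iff₀ hTxy]
        have := mul_le_mul_of_nonneg_left e5 hTxy.le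
        linarith
      have e9 : θ * (κ / 2) ≤ θ * inner ℝ (gradient ρ x) (γ x) :=
        mul_le_mul_of_nonneg_left e1.le hθ0.le
      linarith

namespace NeumannProblem

variable {Ω : Set E} {H : E → E → ℝ} {γ : E → E} {g : E → ℝ}

/-- Upper semicontinuous subsolutions are locally equi-Lipschitz continuous. -/
theorem exists_local_lipschitz (P : NeumannProblem Ω H γ g) (a : ℝ) {z : E}
    (hz : z ∈ closure Ω) :
    ∃ R > 0, ∃ K ≥ 0, ∀ v, UpperSemicontinuousOn v (closure Ω) →
      (∀ x ∈ closure Ω, SubAt Ω H γ g a v x) → ∀ x ∈ closure Ω ∩ Metric.closedBall z R,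
        ∀ y ∈ closure Ω ∩ Metric.closedBall z R, v x - v y ≤ K * ‖x - y‖ := by
  obtain ⟨R₀, hR₀, m, hm, C, d, hd⟩ := P.exists_barrier hz
  obtain ⟨M, hM⟩ := P.exists_norm_le a
  obtain ⟨G, hG⟩ := P.isCompact_frontier.bddAbove_image P.continuousOn_g
  -- With this slope, a multiple of d by at least k has gradient longer than M and derivative along
  -- γ larger than G, so both subsolution alternatives fail.
  set k := (|M| + |G| + 1) / m with hk
  have hk0 : 0 < k := by positivity
  have hkm : k * m = |M| + |G| + 1 := by rw [hk]; field_simp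
  -- On the sphere of radius R₀/2 about y the barrier is at least 2s, while R is small enough that
  -- it is below s at the points to be compared.
  set s := m * R₀ / 4 with hs
  have hs0 : 0 < s := by positivity
  obtain ⟨R, hR, hRR₀, hRs⟩ : ∃ R > 0, R ≤ R₀ / 4 ∧ |C| * (2 * R) < s := by
    refine ⟨min (R₀ / 4) (s / (4 * (|C| + 1))), by positivity, min_le_left _ _, ?_⟩
    have h1 : |C| * (2 * min (R₀ / 4) (s / (4 * (|C| + 1)))) ≤
        (|C| + 1) * (2 * (s / (4 * (|C| + 1)))) := by
      gcongr
      · linarith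
      · exact min_le_right _ _
    have h2 : (|C| + 1) * (2 * (s / (4 * (|C| + 1)))) = s / 2 := by field_simp; norm_num
    linarith
  refine ⟨R, hR, k * |C|, by positivity, fun v hv hsub x hx y hy => ?_⟩
  have hballs : ∀ w ∈ closure Ω ∩ Metric.closedBall y (R₀ / 2),
      w ∈ closure Ω ∩ Metric.closedBall z R₀ := fun w hw => ⟨hw.1, by
    have h1 : dist w y ≤ R₀ / 2 := hw.2
    have h2 : dist y z ≤ R := hy.2
    have := dist_triangle w y z
    exact Metric.mem_closedBall.2 (by linarith)⟩
  have hyy : y ∈ closure Ω ∩ Metric.closedBall y (R₀ / 2) :=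
    ⟨hy.1, Metric.mem_closedBall_self (by positivity)⟩
  obtain ⟨hd0, hdc, hdx⟩ := hd y (hballs y hyy)
  have hxy2 : ‖x - y‖ ≤ 2 * R := by
    rw [← dist_eq_norm]
    have h1 : dist x z ≤ R := hx.2
    have h2 : dist y z ≤ R := hy.2
    have := dist_triangle_right x y z
    linarith
  have hxb : x ∈ closure Ω ∩ Metric.closedBall y (R₀ / 2) :=
    ⟨hx.1, by rw [mem_closedBall_iff_norm]; linarith⟩
  obtain ⟨B, hB⟩ := hv.bddAbove_of_isCompact P.isCompact_closure
  have hB' : ∀ w ∈ closure Ω, v w ≤ B := fun w hw => hB (mem_image_of_mem v hw)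
  -- The power is at least 2^j on the sphere of radius R₀/2, which keeps the maximum inside for
  -- large j, and it tends to 0 at x. How large j must be depends on v, but the limiting bound does
  -- not.
  have key : ∀ᶠ j : ℕ in atTop, v x - v y ≤ k * d y x + (d y x / s) ^ j := by
    filter_upwards [(tendsto_pow_atTop_atTop_of_one_lt (one_lt_two (α := ℝ))).eventually_gt_atTop
      (B - v y), eventually_ge_atTop 1] with j hj hj1
    have hc : IsCompact (closure Ω ∩ Metric.closedBall y (R₀ / 2)) :=
      (isCompact_closedBall _ _).inter_left isClosed_closure
    have hcont : ContinuousOn (fun w => -(k * d y w + (d y w / s) ^ j))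
        (closure Ω ∩ Metric.closedBall y (R₀ / 2)) := by
      have := hdc.mono fun w hw => (hballs w hw).2
      fun_prop
    obtain ⟨w, hw, hmax⟩ := UpperSemicontinuousOn.exists_isMaxOn ⟨y, hyy⟩ hc
      ((hv.mono inter_subset_left).add hcont.upperSemicontinuousOn)
    have hmax' : ∀ x' ∈ closure Ω ∩ Metric.closedBall y (R₀ / 2),
        v x' - (k * d y x' + (d y x' / s) ^ j) ≤ v w - (k * d y w + (d y w / s) ^ j) := hmax
    have hwy := hmax' y hyy
    rw [hd0, zero_div, zero_pow (by omega), mul_zero] at hwy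
    obtain ⟨hdw1, -, hdw3⟩ := hdx w (hballs w hw)
    have hdw0 : 0 ≤ d y w := le_trans (by positivity) hdw1
    by_cases hwe : w = y
    · have := hmax' x hxb
      rw [hwe, hd0, zero_div, zero_pow (by omega), mul_zero] at this
      linarith
    exfalso
    have hwlt : dist w y < R₀ / 2 := by
      by_contra hcon
      push Not at hcon
      rw [dist_eq_norm] at hcon
      have h1 : 2 ≤ d y w / s := by
        rw [le_div_iff₀ hs0, hs]
        nlinarith
      have h2 : (2 : ℝ) ^ j ≤ (d y w / s) ^ j := pow_le_pow_left₀ zero_le_two h1 j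
      have h3 := hB' w hw.1
      have h4 : 0 ≤ k * d y w := by positivity
      linarith
    obtain ⟨p, hp, hpn, hpf⟩ := hdw3 hwe
    set χ : ℝ → ℝ := fun t => k * t + (t / s) ^ j with hχ
    have hχd : HasDerivAt χ (k + j * (d y w / s) ^ (j - 1) * (1 / s)) (d y w) := by
      have h1 := ((hasDerivAt_id (d y w)).div_const s).pow j
      have h2 := (hasDerivAt_id (d y w)).const_mul k
      exact (h2.add h1).congr_deriv (by simp)
    have hχc : ContDiffAt ℝ 1 χ (d y w) := by
      have : ContDiff ℝ 1 χ := by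
        simp only [hχ, div_eq_mul_inv]
        fun_prop
      exact this.contDiffAt
    set t := k + j * (d y w / s) ^ (j - 1) * (1 / s) with ht
    have htk : k ≤ t := by
      have : 0 ≤ j * (d y w / s) ^ (j - 1) * (1 / s) := by positivity
      linarith
    have hmem : t • p ∈ superdiff (closure Ω) v w :=
      ⟨_, C1At.comp hχc hχd hp, isLocalMaxOn_of_inter_closedBall hwlt hmax'⟩
    have htm : |M| + |G| + 1 ≤ t * m := by
      rw [← hkm]
      exact mul_le_mul_of_nonneg_right htk hm.le
    have ht0 : 0 ≤ t := hk0.le.trans htk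
    have hH : ¬ H w (t • p) ≤ a := fun hcon => by
      have h1 := hM w hw.1 _ hcon
      rw [norm_smul, Real.norm_of_nonneg ht0] at h1
      have h2 := mul_le_mul_of_nonneg_left hpn ht0
      have h3 := le_abs_self M
      have h4 := abs_nonneg G
      linarith
    obtain ⟨hs1, hs2⟩ := hsub w hw.1 _ hmem
    rcases mem_or_mem_frontier hw.1 with hwΩ | hwf
    · exact hH (hs1 hwΩ)
    · rcases hs2 hwf with h | h
      · exact hH h
      · rw [inner_smul_right] at h
        have h1 := mul_le_mul_of_nonneg_left (hpf hwf) ht0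
        have h2 : g w ≤ G := hG (mem_image_of_mem g hwf)
        have h3 := le_abs_self G
        have h4 := abs_nonneg M
        linarith
  obtain ⟨hdx1, hdx2, -⟩ := hdx x (hballs x hxb)
  have hdx0 : 0 ≤ d y x := le_trans (by positivity) hdx1
  have hdC : d y x ≤ |C| * ‖x - y‖ :=
    hdx2.trans (mul_le_mul_of_nonneg_right (le_abs_self C) (norm_nonneg _))
  have hdlt : d y x / s < 1 := by
    rw [div_lt_one hs0]
    have := mul_le_mul_of_nonneg_left hxy2 (abs_nonneg C)
    linarith
  have hlim : Tendsto (fun j : ℕ => k * d y x + (d y x / s) ^ j) atTop (𝓝 (k * d y x + 0)) :=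
    tendsto_const_nhds.add (tendsto_pow_atTop_nhds_zero_of_lt_one (by positivity) hdlt)
  have h1 := ge_of_tendsto hlim key
  rw [add_zero] at h1
  calc v x - v y ≤ k * d y x := h1
    _ ≤ k * (|C| * ‖x - y‖) := mul_le_mul_of_nonneg_left hdC hk0.le
    _ = k * |C| * ‖x - y‖ := by ring

end NeumannProblem

end Problem


/-! ### The boundary condition in tangential form -/

section Boundary

variable {E : Type*} [NormedAddCommGroup E] [InnerProductSpace ℝ E] [FiniteDimensional ℝ E]

theorem exists_lipschitz_closedBall {X : Type*} [SeminormedAddCommGroup X] {S : Set X} {u : X → ℝ}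
    (hu : LocallyLipschitzOn S u) {z : X} (hz : z ∈ S) :
    ∃ R > 0, ∃ K ≥ 0, ∀ x ∈ S ∩ Metric.closedBall z R, ∀ y ∈ S ∩ Metric.closedBall z R,
      u x - u y ≤ K * ‖x - y‖ := by
  obtain ⟨K, t, ht, hK⟩ := hu hz
  obtain ⟨R, hR, hR'⟩ := exists_closedBall_of_eventually_within (P := (· ∈ t)) ht
  refine ⟨R, hR, K, K.2, fun x hx y hy => ?_⟩
  have h1 := hK.dist_le_mul x (hR' x hx) y (hR' y hy)
  rw [dist_eq_norm, dist_eq_norm] at h1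
  exact (le_abs_self _).trans h1

theorem locallyLipschitzOn_of_closedBall {X : Type*} [SeminormedAddCommGroup X] {S : Set X}
    {u : X → ℝ} (h : ∀ z ∈ S, ∃ R > 0, ∃ K ≥ 0, ∀ x ∈ S ∩ Metric.closedBall z R,
      ∀ y ∈ S ∩ Metric.closedBall z R, u x - u y ≤ K * ‖x - y‖) : LocallyLipschitzOn S u := by
  intro z hz
  obtain ⟨R, hR, K, hK, h1⟩ := h z hz
  refine ⟨K.toNNReal, S ∩ Metric.closedBall z R,
    inter_mem_nhdsWithin S (Metric.closedBall_mem_nhds z hR), LipschitzOnWith.of_dist_le_mul ?_⟩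
  intro x hx y hy
  rw [dist_eq_norm, dist_eq_norm, Real.coe_toNNReal K hK, Real.norm_eq_abs, abs_le]
  have h2 := h1 x hx y hy
  have h3 := h1 y hy x hx
  rw [norm_sub_rev] at h3
  constructor <;> linarith

namespace IsChart

variable {Ω : Set E} {ρ : E → ℝ} {z : E}

theorem apply_eq_zero (hρ : IsChart Ω ρ z) (hz : z ∈ frontier Ω) : ρ z = 0 :=
  hρ.eventually.self_of_nhds.2.2.2.1 hz

theorem eventually_mem (hρ : IsChart Ω ρ z) (hz : z ∈ frontier Ω) {w : E}
    (hw : 0 < inner ℝ (gradient ρ z) w) : ∀ᶠ t : ℝ in 𝓝[>] 0, z - t • w ∈ Ω := by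
  set ε := inner ℝ (gradient ρ z) w / (2 * (‖w‖ + 1)) with hε
  have hε0 : 0 < ε := by positivity
  have hε1 : ε * (‖w‖ + 1) = inner ℝ (gradient ρ z) w / 2 := by
    rw [hε]
    field_simp
  obtain ⟨r, hr, hr'⟩ := hρ.c1At.strict_expansion hε0
  have ht : Tendsto (fun t : ℝ => z - t • w) (𝓝[>] 0) (𝓝 z) := by
    have : Tendsto (fun t : ℝ => z - t • w) (𝓝 0) (𝓝 (z - (0 : ℝ) • w)) :=
      Continuous.tendsto (by fun_prop) 0
    simpa using this.mono_left nhdsWithin_le_nhds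
  filter_upwards [ht.eventually hρ.mem_iff, ht.eventually (Metric.closedBall_mem_nhds z hr),
    self_mem_nhdsWithin] with t h1 h2 h3
  have h3' : (0 : ℝ) < t := h3
  refine h1.2 ?_
  have h4 := (abs_le.1 (hr' _ h2 z (Metric.mem_closedBall_self hr.le))).2
  have e1 : z - t • w - z = -(t • w) := by abel
  rw [e1, inner_neg_right, inner_smul_right, norm_neg, norm_smul, Real.norm_of_nonneg h3'.le,
    hρ.apply_eq_zero hz] at h4
  have h5 : 0 < t * inner ℝ (gradient ρ z) w := by positivity
  have h6 : t * (ε * (‖w‖ + 1)) = t * (inner ℝ (gradient ρ z) w / 2) := by rw [hε1]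
  have h7 : 0 < t * ε := by positivity
  nlinarith

/-- Superdifferentials at a boundary point are stable under subtraction of normal vectors. -/
theorem sub_smul_mem (hρ : IsChart Ω ρ z) (hz : z ∈ frontier Ω) {u : E → ℝ} {q : E}
    (hq : q ∈ superdiff (closure Ω) u z) {t : ℝ} (ht : 0 ≤ t) :
    q - t • gradient ρ z ∈ superdiff (closure Ω) u z := by
  obtain ⟨φ, hφ, hmax⟩ := hq
  refine ⟨_, hφ.sub (hρ.c1At.const_mul t), ?_⟩
  filter_upwards [hmax, self_mem_nhdsWithin, nhdsWithin_le_nhds hρ.eventually] with y h1 h2 h3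
  have h4 := h3.2.2.1 h2
  rw [hρ.apply_eq_zero hz]
  have := mul_nonneg ht (neg_nonneg.2 h4)
  linarith

/-- From a point y of the closure near z, the ray along n meets the boundary at distance at most
2(-ρ(y))/‖n‖. The Lipschitz cost (K + L) times this distance is paid for by subtracting a large
enough multiple of ρ from the test function. -/
theorem exists_sub_smul_mem (hρ : IsChart Ω ρ z) (hz : z ∈ frontier Ω) {u : E → ℝ}
    (hu : LocallyLipschitzOn (closure Ω) u) {p : E} (hp : p ∈ superdiff (frontier Ω) u z) :
    ∃ t : ℝ, p - t • gradient ρ z ∈ superdiff (closure Ω) u z := by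
  obtain ⟨φ, hφ, hmax⟩ := hp
  obtain ⟨R, hR, K, hK0, hK⟩ := exists_lipschitz_closedBall hu hz.1
  set n := gradient ρ z with hn
  have hn0 : 0 < ‖n‖ := norm_pos_iff.2 hρ.gradient_ne_zero
  obtain ⟨L, hL0, r1, hr1, h1⟩ := hφ.exists_lipschitz
  obtain ⟨r2, hr2, h2⟩ := hρ.c1At.strict_expansion (half_pos hn0)
  obtain ⟨r3, hr3, h3⟩ := exists_closedBall_of_eventually hρ.eventually
  obtain ⟨r4, hr4, h4⟩ := exists_closedBall_of_eventually_within hmax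
  obtain ⟨r, hr, hrR, hrr1, hrr2, hrr3, hrr4⟩ :
      ∃ r > 0, r ≤ R ∧ r ≤ r1 ∧ r ≤ r2 ∧ r ≤ r3 ∧ r ≤ r4 :=
    ⟨min R (min (min r1 r2) (min r3 r4)), by positivity, min_le_left _ _,
      (min_le_right _ _).trans ((min_le_left _ _).trans (min_le_left _ _)),
      (min_le_right _ _).trans ((min_le_left _ _).trans (min_le_right _ _)),
      (min_le_right _ _).trans ((min_le_right _ _).trans (min_le_left _ _)),
      (min_le_right _ _).trans ((min_le_right _ _).trans (min_le_right _ _))⟩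
  have hsub : ∀ {s}, r ≤ s → ∀ x ∈ Metric.closedBall z r, x ∈ Metric.closedBall z s :=
    fun hs x hx => Metric.closedBall_subset_closedBall hs hx
  have hρz := hρ.apply_eq_zero hz
  refine ⟨2 * (K + L) / ‖n‖, _, hφ.sub (hρ.c1At.const_mul _), ?_⟩
  have hev : ∀ᶠ y in 𝓝 z, ‖y - z‖ + 2 * (-ρ y) / ‖n‖ < r := by
    have hc : ContinuousAt (fun y => ‖y - z‖ + 2 * (-ρ y) / ‖n‖) z :=
      ContinuousAt.add (by fun_prop) (((hρ.c1At.continuousAt.neg).const_mul 2).div_const _)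
    refine hc.eventually_lt_const ?_
    simpa [hρz] using hr
  filter_upwards [self_mem_nhdsWithin, nhdsWithin_le_nhds hev,
    nhdsWithin_le_nhds (Metric.closedBall_mem_nhds z hr)] with y hyc hyr hyb
  have hρy : ρ y ≤ 0 := (h3 y (hsub hrr3 y hyb)).2.2.1 hyc
  -- By the expansion with error ‖n‖/2, ρ grows along n at rate at least ‖n‖²/2, so it is
  -- nonnegative after parameter τ.
  set τ := 2 * (-ρ y) / ‖n‖ ^ 2 with hτ
  have hτ0 : 0 ≤ τ := div_nonneg (by linarith) (by positivity)
  have hτn : τ * ‖n‖ = 2 * (-ρ y) / ‖n‖ := by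
    rw [hτ]
    field_simp
  have hball : ∀ s ∈ Icc 0 τ, y + s • n ∈ Metric.closedBall z r := fun s hs => by
    rw [mem_closedBall_iff_norm]
    have e1 : y + s • n - z = (y - z) + s • n := by abel
    have e2 := norm_add_le (y - z) (s • n)
    rw [norm_smul, Real.norm_of_nonneg hs.1] at e2
    have e3 := mul_le_mul_of_nonneg_right hs.2 hn0.le
    rw [e1]
    linarith
  have hcont : ContinuousOn (fun s : ℝ => ρ (y + s • n)) (Icc 0 τ) := by
    intro s hs
    have hc : ContinuousAt ρ (y + s • n) := (h3 _ (hsub hrr3 _ (hball s hs))).1.continuousAt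
    have hc' : ContinuousAt (fun s : ℝ => y + s • n) s := by fun_prop
    exact (ContinuousAt.comp (f := fun s : ℝ => y + s • n) hc hc').continuousWithinAt
  have hend : 0 ≤ ρ (y + τ • n) := by
    have e := (abs_le.1 (h2 _ (hsub hrr2 _ (hball τ ⟨hτ0, le_rfl⟩)) y (hsub hrr2 _ hyb))).1
    rw [add_sub_cancel_left, inner_smul_right, real_inner_self_eq_norm_sq, norm_smul,
      Real.norm_of_nonneg hτ0] at e
    have e2 : τ * ‖n‖ ^ 2 = 2 * (-ρ y) := by
      rw [hτ]
      field_simp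
    nlinarith
  obtain ⟨s, hs, hs0⟩ := intermediate_value_Icc hτ0 hcont
    (show (0 : ℝ) ∈ Icc _ _ from ⟨by simpa using hρy, hend⟩)
  have hyf : y + s • n ∈ frontier Ω := (h3 _ (hsub hrr3 _ (hball s hs))).2.2.2.2 hs0
  have e1 := hK y ⟨hyc, hsub hrR _ hyb⟩ (y + s • n) ⟨hyf.1, hsub hrR _ (hball s hs)⟩
  have e2 := (abs_le.1 (h1 _ (hsub hrr1 _ (hball s hs)) y (hsub hrr1 _ hyb))).2
  have e3 := h4 (y + s • n) ⟨hyf, hsub hrr4 _ (hball s hs)⟩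
  rw [norm_sub_rev] at e1
  rw [add_sub_cancel_left, norm_smul, Real.norm_of_nonneg hs.1] at e1 e2
  have e4 := mul_le_mul_of_nonneg_right hs.2 hn0.le
  rw [hτn] at e4
  have e5 := mul_le_mul_of_nonneg_left e4 (add_nonneg hK0 hL0)
  have e6 : 2 * (K + L) / ‖n‖ * ρ y = -((K + L) * (2 * (-ρ y) / ‖n‖)) := by ring
  rw [hρz, e6]
  linarith

/-- The points z - t n are in Ω for small t > 0, and u can fall there by at most K t‖n‖. This bounds
the normal component from above only; below it is unbounded, by `sub_smul_mem`. -/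
theorem exists_inner_le (hρ : IsChart Ω ρ z) (hz : z ∈ frontier Ω) {u : E → ℝ}
    (hu : LocallyLipschitzOn (closure Ω) u) :
    ∃ C, ∀ q ∈ superdiff (closure Ω) u z, inner ℝ q (gradient ρ z) ≤ C := by
  obtain ⟨R, hR, K, hK0, hK⟩ := exists_lipschitz_closedBall hu hz.1
  set n := gradient ρ z with hn
  have hn0 : 0 < ‖n‖ := norm_pos_iff.2 hρ.gradient_ne_zero
  refine ⟨(K + 1) * ‖n‖, fun q hq => ?_⟩
  obtain ⟨φ, hφ, hmax⟩ := hq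
  obtain ⟨r1, hr1, h1⟩ := hφ.strict_expansion one_pos
  have ht : Tendsto (fun t : ℝ => z - t • n) (𝓝[>] 0) (𝓝 z) := by
    have : Tendsto (fun t : ℝ => z - t • n) (𝓝 0) (𝓝 (z - (0 : ℝ) • n)) :=
      Continuous.tendsto (by fun_prop) 0
    simpa using this.mono_left nhdsWithin_le_nhds
  obtain ⟨t, a1, a2, a3, a4, a5⟩ := ((hρ.eventually_mem hz (w := n)
    (by rw [real_inner_self_eq_norm_sq]; positivity)).and
    ((ht.eventually (Metric.closedBall_mem_nhds z hR)).and
    ((ht.eventually (Metric.closedBall_mem_nhds z hr1)).and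
    ((ht.eventually (eventually_nhdsWithin_iff.1 hmax)).and self_mem_nhdsWithin)))).exists
  have ht0 : (0 : ℝ) < t := a5
  have e1 := hK z ⟨hz.1, Metric.mem_closedBall_self hR.le⟩ _ ⟨subset_closure a1, a2⟩
  have e2 := (abs_le.1 (h1 _ a3 z (Metric.mem_closedBall_self hr1.le))).2
  have e3 := a4 (subset_closure a1)
  have e4 : z - t • n - z = -(t • n) := by abel
  have e5 : z - (z - t • n) = t • n := by abel
  rw [e5, norm_smul, Real.norm_of_nonneg ht0.le] at e1
  rw [e4, inner_neg_right, inner_smul_right, norm_neg, norm_smul, Real.norm_of_nonneg ht0.le] at e2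
  have e6 : t * inner ℝ q n ≤ t * ((K + 1) * ‖n‖) := by linarith
  exact le_of_mul_le_mul_left e6 ht0

end IsChart

namespace NeumannProblem

variable {Ω : Set E} {H : E → E → ℝ} {γ : E → E} {g : E → ℝ}

/-- If `q` belongs to the superdifferential at a boundary point but `q + δ n` does not, `n` being
normal, then the equation holds at a point of the normal line close to `q`. -/
theorem exists_normal_shift (P : NeumannProblem Ω H γ g) {z : E} (hz : z ∈ frontier Ω)
    {ρ : E → ℝ} (hρ : IsChart Ω ρ z) {u : E → ℝ} {a : ℝ} (hu : ContinuousOn u (closure Ω))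
    (hint : ∀ᶠ x in 𝓝 z, x ∈ Ω → ∀ p ∈ superdiff (closure Ω) u x, H x p ≤ a) {q : E} {δ : ℝ}
    (hδ : 0 < δ) (hq : q ∈ superdiff (closure Ω) u z)
    (hq' : q + δ • gradient ρ z ∉ superdiff (closure Ω) u z) :
    ∃ t ∈ Icc 0 (2 * δ), H z (q + t • gradient ρ z) ≤ a := by
  obtain ⟨φ, hφ, hmax⟩ := hq
  have hρz := hρ.apply_eq_zero hz
  have hstep : ∀ r₀ > 0, ∃ x ∈ Ω, dist x z < r₀ ∧ ∃ t ∈ Icc 0 (2 * δ),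
      H x (gradient φ x + (2 : ℝ) • (x - z) + t • gradient ρ x) ≤ a := by
    intro r₀ hr₀
    obtain ⟨r1, hr1, h1⟩ := exists_closedBall_of_eventually
      (hφ.eventually.and (hρ.eventually.and hint))
    obtain ⟨r2, hr2, h2⟩ := exists_closedBall_of_eventually_within hmax
    obtain ⟨r, hr, hrr₀, hrr1, hrr2⟩ : ∃ r > 0, r ≤ r₀ ∧ r ≤ r1 ∧ r ≤ r2 :=
      ⟨min r₀ (min r1 r2), by positivity, min_le_left _ _,
        (min_le_right _ _).trans (min_le_left _ _), (min_le_right _ _).trans (min_le_right _ _)⟩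
    have hsub : ∀ {s}, r ≤ s → ∀ x ∈ Metric.closedBall z r, x ∈ Metric.closedBall z s :=
      fun hs x hx => Metric.closedBall_subset_closedBall hs hx
    -- Chosen so that the lower bound -2δh of the function f below equals -r²/2; this confines the
    -- maximum to the open ball.
    set h := r ^ 2 / (4 * δ) with hh
    have hh0 : 0 < h := by positivity
    have hh1 : 2 * δ * h = r ^ 2 / 2 := by
      rw [hh]
      field_simp
      norm_num
    -- Since q + δn is not a superdifferential, the test function with δρ and the quadratic term
    -- added must fail arbitrarily close to z.
    have hnot : ∃ᶠ y in 𝓝[closure Ω] z,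
        u z - φ z < u y - (φ y + ‖y - z‖ ^ 2 + δ * ρ y) := by
      intro hcon
      refine hq' ⟨fun y => φ y + ‖y - z‖ ^ 2 + δ * ρ y, ?_, ?_⟩
      · simpa using (hφ.add (C1At.norm_sub_sq z z)).add (hρ.c1At.const_mul δ)
      · filter_upwards [hcon] with y hy
        simpa [hρz] using hy
    obtain ⟨y, hy1, hyc, hyr, hyh⟩ := (hnot.and_eventually (eventually_mem_nhdsWithin.and
      ((eventually_nhdsWithin_of_eventually_nhds (Metric.closedBall_mem_nhds z hr)).and
      (eventually_nhdsWithin_of_eventually_nhds (hρ.c1At.continuousAt.eventually_const_lt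
        (show -h < ρ z by rw [hρz]; linarith)))))).exists
    have hρneg : ∀ x ∈ closure Ω ∩ Metric.closedBall z r, ρ x ≤ 0 := fun x hx =>
      (h1 x (hsub hrr1 x hx.2)).2.1.2.2.1 hx.1
    -- A bounded substitute for δt on t ≤ 0: f(0) = 0, 0 ≤ f' ≤ 2δ, f ≥ -2δh, and f(t) ≤ δt for -h ≤
    -- t ≤ 0, so the violation found at y persists.
    set f : ℝ → ℝ := fun t => 2 * δ * h * (t / (h - t)) with hf
    have hfd : ∀ t ≤ 0, HasDerivAt f (2 * δ * h * (h / (h - t) ^ 2)) t ∧ ContDiffAt ℝ 1 f t := by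
      intro t ht
      have hne : h - t ≠ 0 := by linarith
      constructor
      · have := ((hasDerivAt_id t).div ((hasDerivAt_id t).const_sub h) hne).const_mul (2 * δ * h)
        refine this.congr_deriv ?_
        simp
      · exact contDiffAt_const.mul (contDiffAt_id.div (contDiffAt_const.sub contDiffAt_id) hne)
    have hflow : ∀ t ≤ 0, -(2 * δ * h) ≤ f t := by
      intro t ht
      have h0 : 0 < h - t := by linarith
      have h2 : -1 ≤ t / (h - t) := by
        rw [le_div_iff₀ h0]
        linarith
      have := mul_le_mul_of_nonneg_left h2 (by positivity : 0 ≤ 2 * δ * h)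
      simp only [hf]
      linarith
    have hc : IsCompact (closure Ω ∩ Metric.closedBall z r) :=
      (isCompact_closedBall _ _).inter_left isClosed_closure
    have hcont : ContinuousOn (fun x => u x - (φ x + ‖x - z‖ ^ 2 + f (ρ x)))
        (closure Ω ∩ Metric.closedBall z r) := by
      refine (hu.mono inter_subset_left).sub fun x hx => ContinuousAt.continuousWithinAt ?_
      have b := h1 x (hsub hrr1 x hx.2)
      refine (b.1.continuousAt.add (by fun_prop)).add ?_
      exact ContinuousAt.comp (g := f) (hfd _ (hρneg x hx)).1.continuousAt b.2.1.1.continuousAt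
    obtain ⟨x, hx, hxm⟩ := hc.exists_isMaxOn ⟨y, hyc, hyr⟩ hcont
    have hxy : u y - (φ y + ‖y - z‖ ^ 2 + f (ρ y)) ≤ u x - (φ x + ‖x - z‖ ^ 2 + f (ρ x)) :=
      hxm ⟨hyc, hyr⟩
    have hfy : f (ρ y) ≤ δ * ρ y := by
      have hy0 := hρneg y ⟨hyc, hyr⟩
      have h0 : 0 < h - ρ y := by linarith
      have e : f (ρ y) - δ * ρ y = δ * ρ y * ((h + ρ y) / (h - ρ y)) := by
        simp only [hf]
        field_simp
        ring
      have : δ * ρ y * ((h + ρ y) / (h - ρ y)) ≤ 0 :=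
        mul_nonpos_of_nonpos_of_nonneg (mul_nonpos_of_nonneg_of_nonpos hδ.le hy0)
          (div_nonneg (by linarith) h0.le)
      linarith
    have hx2 : u x - φ x ≤ u z - φ z := h2 x ⟨hx.1, hsub hrr2 x hx.2⟩
    have hρx := hρneg x hx
    have hxz : ‖x - z‖ < r := by
      refine lt_of_pow_lt_pow_left₀ 2 hr.le ?_
      have := hflow _ hρx
      have : 0 < r ^ 2 := by positivity
      linarith
    have hb := h1 x (hsub hrr1 x hx.2)
    -- On the boundary f(ρ) = 0, and there the maximality of u - φ at z excludes the strict excess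
    -- inherited from y. Hence the interior equation applies at x.
    have hxΩ : x ∈ Ω := by
      rcases mem_or_mem_frontier hx.1 with hxΩ | hxf
      · exact hxΩ
      · exfalso
        have e0 := hb.2.1.2.2.2.1 hxf
        have e1 : f (ρ x) = 0 := by simp [hf, e0]
        have := sq_nonneg ‖x - z‖
        linarith
    have hd0 : 0 < h - ρ x := by linarith
    refine ⟨x, hxΩ, by rw [dist_eq_norm]; linarith, 2 * δ * h * (h / (h - ρ x) ^ 2),
      ⟨by positivity, ?_⟩, hb.2.2 hxΩ _ ⟨_, (hb.1.add (C1At.norm_sub_sq z x)).add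
        (C1At.comp (hfd _ hρx).2 (hfd _ hρx).1 hb.2.1.1),
        isLocalMaxOn_of_inter_closedBall (by rw [dist_eq_norm]; exact hxz) hxm⟩⟩
    have e : 2 * δ * h * (h / (h - ρ x) ^ 2) = 2 * δ * (h ^ 2 / (h - ρ x) ^ 2) := by ring
    rw [e]
    refine mul_le_of_le_one_right (by positivity) (div_le_one_of_le₀ ?_ (by positivity))
    exact pow_le_pow_left₀ hh0.le (by linarith) 2
  choose x hx hxz t ht hH using fun k : ℕ => hstep (1 / ((k : ℝ) + 1)) Nat.one_div_pos_of_nat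
  obtain ⟨t₀, ht₀, θ, hθ, htt⟩ := isCompact_Icc.tendsto_subseq ht
  refine ⟨t₀, ht₀, ?_⟩
  have hxt : Tendsto (fun k => x (θ k)) atTop (𝓝 z) := by
    have h1 : Tendsto x atTop (𝓝 z) := by
      rw [tendsto_iff_dist_tendsto_zero]
      exact squeeze_zero (fun _ => dist_nonneg) (fun k => (hxz k).le)
        tendsto_one_div_add_atTop_nhds_zero_nat
    exact h1.comp hθ.tendsto_atTop
  have hpt : Tendsto (fun k => gradient φ (x (θ k)) + (2 : ℝ) • (x (θ k) - z) +
      t (θ k) • gradient ρ (x (θ k))) atTop (𝓝 (q + t₀ • gradient ρ z)) := by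
    have h1 := hφ.continuousAt_gradient.tendsto.comp hxt
    have h2 := hρ.c1At.continuousAt_gradient.tendsto.comp hxt
    rw [hφ.gradient_eq] at h1
    have h3 := (hxt.sub_const z).const_smul (2 : ℝ)
    rw [sub_self, smul_zero] at h3
    simpa using (h1.add h3).add (htt.smul h2)
  exact le_of_tendsto (P.tendsto_H hz.1 (Eventually.of_forall fun k => subset_closure (hx _))
    hxt hpt) (Eventually.of_forall fun k => hH _)

/-- The maximal normal translate of a tangential superdifferential. -/
theorem exists_max_shift (P : NeumannProblem Ω H γ g) {z : E} (hz : z ∈ frontier Ω)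
    {ρ : E → ℝ} (hρ : IsChart Ω ρ z) {u : E → ℝ} {a : ℝ}
    (hu : LocallyLipschitzOn (closure Ω) u)
    (hint : ∀ᶠ x in 𝓝 z, x ∈ Ω → ∀ p ∈ superdiff (closure Ω) u x, H x p ≤ a) {p : E}
    (hp : p ∈ superdiff (frontier Ω) u z) :
    ∃ s : ℝ, H z (p + s • gradient ρ z) ≤ a ∧
      (∀ t < s, p + t • gradient ρ z ∈ superdiff (closure Ω) u z) ∧
      ∀ t, p + t • gradient ρ z ∈ superdiff (closure Ω) u z → t ≤ s := by
  set n := gradient ρ z with hn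
  have hn0 : 0 < ‖n‖ := norm_pos_iff.2 hρ.gradient_ne_zero
  set T : Set ℝ := {t | p + t • n ∈ superdiff (closure Ω) u z} with hT
  have hne : T.Nonempty := by
    obtain ⟨t, ht⟩ := hρ.exists_sub_smul_mem hz hu hp
    exact ⟨-t, by simpa [hT, sub_eq_add_neg] using ht⟩
  have hbd : BddAbove T := by
    obtain ⟨C, hC⟩ := hρ.exists_inner_le hz hu
    refine ⟨(C - inner ℝ p n) / ‖n‖ ^ 2, fun t ht => ?_⟩
    have h1 := hC _ ht
    rw [inner_add_left, inner_smul_left, real_inner_self_eq_norm_sq] at h1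
    simp only [conj_trivial] at h1
    rw [le_div_iff₀ (by positivity)]
    linarith
  have hdown : ∀ t ∈ T, ∀ t' ≤ t, t' ∈ T := fun t ht t' ht' => by
    have h1 := hρ.sub_smul_mem hz ht (sub_nonneg.2 ht')
    have e : p + t • n - (t - t') • gradient ρ z = p + t' • n := by
      rw [← hn]
      module
    rw [e] at h1
    exact h1
  refine ⟨sSup T, ?_, fun t ht => ?_, fun t ht => le_csSup hbd ht⟩
  · have hcl : IsClosed {s : ℝ | H z (p + s • n) ≤ a} := by
      have hcont : Continuous fun s : ℝ => H z (p + s • n) := by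
        refine continuous_iff_continuousAt.2 fun s => ?_
        refine P.tendsto_H (x := fun _ => z) hz.1 (Eventually.of_forall fun _ => hz.1)
          tendsto_const_nhds ?_
        exact Continuous.tendsto (by fun_prop) s
      exact isClosed_le hcont continuous_const
    refine hcl.closure_subset (Metric.mem_closure_iff.2 fun ε hε => ?_)
    -- A shift by ε/4 from this s leaves T, so the equation holds at a parameter in [s, s + ε/2],
    -- hence within ε of the supremum; the set of such parameters is closed.
    obtain ⟨s, hs, hs'⟩ := exists_lt_of_lt_csSup hne
      (show sSup T - ε / 8 < sSup T by linarith)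
    have hs1 := le_csSup hbd hs
    have hnot : s + ε / 4 ∉ T := fun hcon => by
      have := le_csSup hbd hcon
      linarith
    obtain ⟨t, ht, htH⟩ := P.exists_normal_shift hz hρ hu.continuousOn hint
      (show 0 < ε / 4 by positivity) hs (by
        rw [← hn, add_assoc, ← add_smul]
        exact hnot)
    refine ⟨s + t, ?_, ?_⟩
    · rw [← hn, add_assoc, ← add_smul] at htH
      exact htH
    · rw [Real.dist_eq, abs_lt]
      constructor <;> linarith [ht.1, ht.2]
  · obtain ⟨s, hs, hs'⟩ := exists_lt_of_lt_csSup hne ht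
    exact hdown s hs t hs'.le

/-- The boundary condition in tangential form: necessity. -/
theorem exists_smul_of_subAt (P : NeumannProblem Ω H γ g) {z : E} (hz : z ∈ frontier Ω)
    {ρ : E → ℝ} (hρ : IsChart Ω ρ z) (hκ : 0 < inner ℝ (gradient ρ z) (γ z)) {u : E → ℝ} {a : ℝ}
    (hu : LocallyLipschitzOn (closure Ω) u)
    (hint : ∀ᶠ x in 𝓝 z, x ∈ Ω → ∀ p ∈ superdiff (closure Ω) u x, H x p ≤ a)
    (hsub : SubAt Ω H γ g a u z) {p : E} (hp : p ∈ superdiff (frontier Ω) u z) :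
    ∃ s : ℝ, H z (p + s • gradient ρ z) ≤ a ∧ inner ℝ (γ z) (p + s • gradient ρ z) ≤ g z := by
  obtain ⟨s, hs, hlt, -⟩ := P.exists_max_shift hz hρ hu hint hp
  set n := gradient ρ z with hn
  by_cases hg : inner ℝ (γ z) (p + s • n) ≤ g z
  · exact ⟨s, hs, hg⟩
  push Not at hg
  have hexp : ∀ t : ℝ, inner ℝ (γ z) (p + t • n) = inner ℝ (γ z) p + t * inner ℝ n (γ z) :=
    fun t => by rw [inner_add_right, inner_smul_right, real_inner_comm n]
  -- Parameter at which γ·(p + s₁n) = g. Between s₁ and s the shifted vectors are superdifferentials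
  -- violating the boundary inequality, so H ≤ a there; let the parameter decrease to s₁.
  set s₁ := (g z - inner ℝ (γ z) p) / inner ℝ n (γ z) with hs₁
  have hs₁' : s₁ * inner ℝ n (γ z) = g z - inner ℝ (γ z) p := div_mul_cancel₀ _ hκ.ne'
  have hs₁s : s₁ < s := by
    rw [hexp] at hg
    rw [hs₁, div_lt_iff₀ hκ]
    linarith
  refine ⟨s₁, ?_, by rw [hexp, hs₁']; linarith⟩
  have hlim : Tendsto (fun t : ℝ => H z (p + t • n)) (𝓝[>] s₁) (𝓝 (H z (p + s₁ • n))) := by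
    refine P.tendsto_H (x := fun _ => z) hz.1 (Eventually.of_forall fun _ => hz.1)
      tendsto_const_nhds ?_
    exact (Continuous.tendsto (by fun_prop) s₁).mono_left nhdsWithin_le_nhds
  refine le_of_tendsto hlim ?_
  filter_upwards [Ioo_mem_nhdsGT hs₁s] with t ht
  refine ((hsub _ (hlt t ht.2)).2 hz).resolve_right fun hcon => ?_
  rw [hexp] at hcon
  have := mul_lt_mul_of_pos_right ht.1 hκ
  linarith

/-- The boundary condition in tangential form: sufficiency. -/
theorem subAt_of_exists_smul (P : NeumannProblem Ω H γ g) {z : E} (hz : z ∈ frontier Ω)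
    {ρ : E → ℝ} (hρ : IsChart Ω ρ z) (hκ : 0 < inner ℝ (gradient ρ z) (γ z)) {u : E → ℝ} {a : ℝ}
    (hu : LocallyLipschitzOn (closure Ω) u)
    (hint : ∀ᶠ x in 𝓝 z, x ∈ Ω → ∀ p ∈ superdiff (closure Ω) u x, H x p ≤ a)
    (hbd : ∀ p ∈ superdiff (frontier Ω) u z,
      ∃ s : ℝ, H z (p + s • gradient ρ z) ≤ a ∧ inner ℝ (γ z) (p + s • gradient ρ z) ≤ g z) :
    SubAt Ω H γ g a u z := by
  refine fun p hp => ⟨fun hzΩ => absurd hz (P.notMem_frontier hzΩ), fun _ => ?_⟩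
  have hpf := superdiff_mono frontier_subset_closure u z hp
  obtain ⟨t, ht, -, htle⟩ := P.exists_max_shift hz hρ hu hint hpf
  have ht0 : 0 ≤ t := htle 0 (by simpa using hp)
  obtain ⟨s, hs, hsg⟩ := hbd p hpf
  set n := gradient ρ z with hn
  -- If s ≥ 0, obliquity gives γ·p ≤ γ·(p + sn) ≤ g. If s ≤ 0 ≤ t, then p lies between two points of
  -- the normal line where H ≤ a, and convexity applies.
  rcases le_total 0 s with h0 | h0
  · right
    rw [inner_add_right, inner_smul_right, real_inner_comm n] at hsg
    have := mul_nonneg h0 hκ.le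
    linarith
  · left
    have hseg : p ∈ segment ℝ (p + s • n) (p + t • n) := by
      have h1 : (0 : ℝ) ∈ segment ℝ s t := by
        rw [segment_eq_Icc (h0.trans ht0)]
        exact ⟨h0, ht0⟩
      obtain ⟨a', b', ha', hb', hab, he⟩ := h1
      refine ⟨a', b', ha', hb', hab, ?_⟩
      have e : a' • (p + s • n) + b' • (p + t • n) =
          (a' + b') • p + (a' • s + b' • t) • n := by
        simp only [smul_eq_mul]
        module
      rw [e, he, hab, one_smul, zero_smul, add_zero]
    exact ((P.convexOn_H z hz.1).le_on_segment (mem_univ _) (mem_univ _) hseg).trans (max_le hs ht)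

end NeumannProblem

end Boundary


/-! ### Averages, maximal subsolutions and Perron's method -/

section Subsolutions

variable {E : Type*} [NormedAddCommGroup E] [InnerProductSpace ℝ E] [FiniteDimensional ℝ E]

theorem tendsto_of_dist_lt_one_div {X : Type*} [PseudoMetricSpace X] {x : ℕ → X} {z : X}
    (h : ∀ k : ℕ, dist (x k) z < 1 / ((k : ℝ) + 1)) : Tendsto x atTop (𝓝 z) :=
  tendsto_iff_dist_tendsto_zero.2 (squeeze_zero (fun _ => dist_nonneg) (fun k => (h k).le)
    tendsto_one_div_add_atTop_nhds_zero_nat)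

/-- The bound on the two pieces is independent of the accuracy, so they converge along a subsequence
and their limits average exactly to p. The limits need not be superdifferentials at z; only closed
conditions pass to them. -/
theorem exists_seq_superdiff_half_add {S : Set E} (hS : IsClosed S) {u v : E → ℝ} {z p : E}
    (hz : z ∈ S) (hu : LocallyLipschitzOn S u) (hv : LocallyLipschitzOn S v)
    (hp : p ∈ superdiff S (fun x => (u x + v x) / 2) z) :
    ∃ (x y q q' : ℕ → E) (q₀ q₀' : E), (∀ k, x k ∈ S) ∧ (∀ k, y k ∈ S) ∧
      Tendsto x atTop (𝓝 z) ∧ Tendsto y atTop (𝓝 z) ∧ (∀ k, q k ∈ superdiff S u (x k)) ∧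
      (∀ k, q' k ∈ superdiff S v (y k)) ∧ Tendsto q atTop (𝓝 q₀) ∧ Tendsto q' atTop (𝓝 q₀') ∧
      (1 / 2 : ℝ) • (q₀ + q₀') = p := by
  obtain ⟨R, hR, K, hK0, hK⟩ := exists_lipschitz_closedBall hu hz
  obtain ⟨R', hR', K', hK0', hK'⟩ := exists_lipschitz_closedBall hv hz
  have hsub1 : ∀ x ∈ S ∩ Metric.closedBall z (min R R'), x ∈ S ∩ Metric.closedBall z R :=
    fun x hx => ⟨hx.1, Metric.closedBall_subset_closedBall (min_le_left _ _) hx.2⟩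
  have hsub2 : ∀ x ∈ S ∩ Metric.closedBall z (min R R'), x ∈ S ∩ Metric.closedBall z R' :=
    fun x hx => ⟨hx.1, Metric.closedBall_subset_closedBall (min_le_right _ _) hx.2⟩
  obtain ⟨C, hC⟩ := exists_superdiff_half_add hS hz (K := max K K') (lt_min hR hR')
    (fun x hx y hy => (hK x (hsub1 x hx) y (hsub1 y hy)).trans
      (mul_le_mul_of_nonneg_right (le_max_left _ _) (norm_nonneg _)))
    (fun x hx y hy => (hK' x (hsub2 x hx) y (hsub2 y hy)).trans
      (mul_le_mul_of_nonneg_right (le_max_right _ _) (norm_nonneg _)))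
    hu.continuousOn hv.continuousOn hp
  choose x hx y hy hxz hyz q hq q' hq' hqC hqC' hqp using
    fun k : ℕ => hC (1 / ((k : ℝ) + 1)) Nat.one_div_pos_of_nat
  have hmem : ∀ k, (q k, q' k) ∈ Metric.closedBall (0 : E) C ×ˢ Metric.closedBall (0 : E) C :=
    fun k => ⟨by simpa using hqC k, by simpa using hqC' k⟩
  obtain ⟨⟨q₀, q₀'⟩, -, θ, hθ, hqt⟩ :=
    ((isCompact_closedBall (0 : E) C).prod (isCompact_closedBall (0 : E) C)).tendsto_subseq hmem
  have hq₀ : Tendsto (fun k => q (θ k)) atTop (𝓝 q₀) := (continuous_fst.tendsto _).comp hqt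
  have hq₀' : Tendsto (fun k => q' (θ k)) atTop (𝓝 q₀') := (continuous_snd.tendsto _).comp hqt
  refine ⟨x ∘ θ, y ∘ θ, q ∘ θ, q' ∘ θ, q₀, q₀', fun k => hx _, fun k => hy _,
    (tendsto_of_dist_lt_one_div hxz).comp hθ.tendsto_atTop,
    (tendsto_of_dist_lt_one_div hyz).comp hθ.tendsto_atTop, fun k => hq _, fun k => hq' _,
    hq₀, hq₀', ?_⟩
  have h1 : Tendsto (fun k => (1 / 2 : ℝ) • (q k + q' k)) atTop (𝓝 p) :=
    tendsto_of_dist_lt_one_div fun k => by rw [dist_eq_norm]; exact hqp k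
  exact tendsto_nhds_unique ((hq₀.add hq₀').const_smul (1 / 2 : ℝ)) (h1.comp hθ.tendsto_atTop)

theorem IsChart.eventually_isChart {Ω : Set E} {ρ : E → ℝ} {z : E} (h : IsChart Ω ρ z) :
    ∀ᶠ x in 𝓝 z, IsChart Ω ρ x := by
  filter_upwards [h.c1At.eventually, eventually_eventually_nhds.2 h.mem_iff,
    h.c1At.continuousAt_gradient.eventually_ne h.gradient_ne_zero] with x h1 h2 h3
  exact ⟨h1, h3, h2⟩

theorem superdiff_subset_of_c1At {Ω : Set E} {φ : E → ℝ} {p x q : E} (hΩ : IsOpen Ω)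
    (hφ : C1At φ p x) (hq : q ∈ superdiff (closure Ω) φ x) (hx : x ∈ Ω) : q = p := by
  obtain ⟨ψ, hψ, hmax⟩ := hq
  have hmax' : IsLocalMax (fun y => φ y - ψ y) x :=
    hmax.isLocalMax (mem_of_superset (hΩ.mem_nhds hx) subset_closure)
  have h1 := hmax'.hasFDerivAt_eq_zero (hφ.sub hψ).hasFDerivAt
  rw [map_eq_zero_iff _ (InnerProductSpace.toDual ℝ E).injective] at h1
  exact (sub_eq_zero.1 h1).symm

/-- At a boundary point the maximum can be compared only along inward directions -w, which leaves a
one-sided inequality. With w = γ(z) it carries D_γφ ≤ g over to every superdifferential of φ. -/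
theorem IsChart.inner_le_of_c1At {Ω : Set E} {ρ φ : E → ℝ} {p z q w : E} (hρ : IsChart Ω ρ z)
    (hz : z ∈ frontier Ω) (hw : 0 < inner ℝ (gradient ρ z) w) (hφ : C1At φ p z)
    (hq : q ∈ superdiff (closure Ω) φ z) : inner ℝ w q ≤ inner ℝ w p := by
  obtain ⟨ψ, hψ, hmax⟩ := hq
  have ht : Tendsto (fun t : ℝ => z - t • w) (𝓝[>] 0) (𝓝 z) := by
    have : Tendsto (fun t : ℝ => z - t • w) (𝓝 0) (𝓝 (z - (0 : ℝ) • w)) :=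
      Continuous.tendsto (by fun_prop) 0
    simpa using this.mono_left nhdsWithin_le_nhds
  refine le_of_forall_pos_le_add fun η hη => ?_
  set ε := η / (‖w‖ + 1) with hε
  have hε0 : 0 < ε := by positivity
  have hε1 : ε * (‖w‖ + 1) = η := by
    rw [hε]
    field_simp
  obtain ⟨r, hr, hr'⟩ := (hφ.sub hψ).strict_expansion hε0
  obtain ⟨t, a1, a2, a3, a4⟩ := ((hρ.eventually_mem hz hw).and
    ((ht.eventually (Metric.closedBall_mem_nhds z hr)).and
    ((ht.eventually (eventually_nhdsWithin_iff.1 hmax)).and eventually_mem_nhdsWithin))).exists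
  have ht0 : (0 : ℝ) < t := a4
  have e1 := (abs_le.1 (hr' _ a2 z (Metric.mem_closedBall_self hr.le))).1
  have e2 := a3 (subset_closure a1)
  have e3 : z - t • w - z = -(t • w) := by abel
  rw [e3, inner_neg_right, inner_smul_right, norm_neg, norm_smul, Real.norm_of_nonneg ht0.le,
    real_inner_comm, inner_sub_right] at e1
  have e4 : t * (inner ℝ w q) ≤ t * (inner ℝ w p + ε * ‖w‖) := by linarith
  have e5 := le_of_mul_le_mul_left e4 ht0
  linarith

namespace NeumannProblem

variable {Ω : Set E} {H : E → E → ℝ} {γ : E → E} {g : E → ℝ}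

theorem tendsto_inner (P : NeumannProblem Ω H γ g) {x p : ℕ → E} {z p₀ : E}
    (hz : z ∈ frontier Ω) (hx : ∀ k, x k ∈ frontier Ω) (hxt : Tendsto x atTop (𝓝 z))
    (hpt : Tendsto p atTop (𝓝 p₀)) :
    Tendsto (fun k => inner ℝ (γ (x k)) (p k)) atTop (𝓝 (inner ℝ (γ z) p₀)) ∧
      Tendsto (fun k => g (x k)) atTop (𝓝 (g z)) := by
  have h1 : Tendsto x atTop (𝓝[frontier Ω] z) :=
    tendsto_nhdsWithin_iff.2 ⟨hxt, Eventually.of_forall hx⟩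
  exact ⟨((P.continuousOn_γ z hz).tendsto.comp h1).inner hpt,
    (P.continuousOn_g z hz).tendsto.comp h1⟩

/-- The tangential form of the boundary condition is closed. -/
theorem exists_smul_of_tendsto (P : NeumannProblem Ω H γ g) {z : E} (hz : z ∈ frontier Ω)
    {ρ : E → ℝ} (hρ : IsChart Ω ρ z) {a : ℝ} {x q : ℕ → E} {q₀ : E}
    (hx : ∀ k, x k ∈ frontier Ω) (hxt : Tendsto x atTop (𝓝 z)) (hqt : Tendsto q atTop (𝓝 q₀))
    (h : ∀ᶠ k in atTop, ∃ s : ℝ, H (x k) (q k + s • gradient ρ (x k)) ≤ a ∧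
      inner ℝ (γ (x k)) (q k + s • gradient ρ (x k)) ≤ g (x k)) :
    ∃ s : ℝ, H z (q₀ + s • gradient ρ z) ≤ a ∧ inner ℝ (γ z) (q₀ + s • gradient ρ z) ≤ g z := by
  obtain ⟨M, hM⟩ := P.exists_norm_le a
  have hn0 : 0 < ‖gradient ρ z‖ := norm_pos_iff.2 hρ.gradient_ne_zero
  have hnt : Tendsto (fun k => gradient ρ (x k)) atTop (𝓝 (gradient ρ z)) :=
    hρ.c1At.continuousAt_gradient.tendsto.comp hxt
  obtain ⟨N, hN⟩ := eventually_atTop.1 (h.and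
    ((hnt.norm.eventually_const_lt (half_lt_self hn0)).and
    (hqt.norm.eventually_lt_const (lt_add_one ‖q₀‖))))
  have hsh : Tendsto (fun k => k + N) atTop atTop := tendsto_add_atTop_nat N
  choose s hs hsg using fun k => (hN (k + N) (Nat.le_add_left N k)).1
  -- Coercivity bounds q + s∇ρ, and ∇ρ stays away from 0, so the parameters s remain in a compact
  -- interval.
  set B := (|M| + (‖q₀‖ + 1)) / (‖gradient ρ z‖ / 2) with hB
  have hsB : ∀ k, s k ∈ Icc (-B) B := fun k => by
    rw [mem_Icc, ← abs_le, hB, le_div_iff₀ (half_pos hn0)]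
    obtain ⟨-, h1, h2⟩ := hN (k + N) (Nat.le_add_left N k)
    have h3 := hM _ (hx (k + N)).1 _ (hs k)
    have h4 := norm_sub_le (q (k + N) + s k • gradient ρ (x (k + N))) (q (k + N))
    rw [add_sub_cancel_left, norm_smul, Real.norm_eq_abs] at h4
    have h5 := mul_le_mul_of_nonneg_left h1.le (abs_nonneg (s k))
    have h6 := le_abs_self M
    linarith
  obtain ⟨s₀, -, θ, hθ, hst⟩ := isCompact_Icc.tendsto_subseq hsB
  have hidx : Tendsto (fun k => θ k + N) atTop atTop := hsh.comp hθ.tendsto_atTop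
  have hxt' := hxt.comp hidx
  have hpt : Tendsto (fun k => q (θ k + N) + s (θ k) • gradient ρ (x (θ k + N))) atTop
      (𝓝 (q₀ + s₀ • gradient ρ z)) := (hqt.comp hidx).add (hst.smul (hnt.comp hidx))
  obtain ⟨hi, hg⟩ := P.tendsto_inner hz (fun k => hx _) hxt' hpt
  exact ⟨s₀, le_of_tendsto (P.tendsto_H hz.1 (Eventually.of_forall fun k => (hx _).1) hxt' hpt)
    (Eventually.of_forall fun k => hs _), le_of_tendsto_of_tendsto' hi hg fun k => hsg _⟩

/-- Convexity: half-sums of locally Lipschitz subsolutions are subsolutions. -/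
theorem subAt_half_add (P : NeumannProblem Ω H γ g) {u v : E → ℝ} {a b : ℝ}
    (hu : LocallyLipschitzOn (closure Ω) u) (hv : LocallyLipschitzOn (closure Ω) v) {U : Set E}
    (hU : IsOpen U) (hua : ∀ x ∈ U ∩ closure Ω, SubAt Ω H γ g a u x)
    (hvb : ∀ x ∈ U ∩ closure Ω, SubAt Ω H γ g b v x) :
    ∀ z ∈ U ∩ closure Ω, SubAt Ω H γ g ((a + b) / 2) (fun x => (u x + v x) / 2) z := by
  have hconv : ∀ z ∈ closure Ω, ∀ p q, H z p ≤ a → H z q ≤ b →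
      H z ((1 / 2 : ℝ) • (p + q)) ≤ (a + b) / 2 := by
    intro z hz p q hp hq
    have h1 := (P.convexOn_H z hz).2 (mem_univ p) (mem_univ q) (by norm_num : (0 : ℝ) ≤ 1 / 2)
      (by norm_num : (0 : ℝ) ≤ 1 / 2) (by norm_num)
    rw [← smul_add] at h1
    simp only [smul_eq_mul] at h1
    linarith
  have hint : ∀ z ∈ U, z ∈ Ω → ∀ p ∈ superdiff (closure Ω) (fun x => (u x + v x) / 2) z,
      H z p ≤ (a + b) / 2 := by
    intro z hzU hzΩ p hp
    obtain ⟨x, y, q, q', q₀, q₀', hx, hy, hxt, hyt, hq, hq', hqt, hqt', rfl⟩ :=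
      exists_seq_superdiff_half_add isClosed_closure (subset_closure hzΩ) hu hv hp
    have hUΩ : U ∩ Ω ∈ 𝓝 z := (hU.inter P.isOpen).mem_nhds ⟨hzU, hzΩ⟩
    refine hconv z (subset_closure hzΩ) _ _ ?_ ?_
    · refine le_of_tendsto (P.tendsto_H (subset_closure hzΩ) (Eventually.of_forall hx) hxt hqt) ?_
      filter_upwards [hxt.eventually hUΩ] with k hk
      exact (hua _ ⟨hk.1, hx k⟩ _ (hq k)).1 hk.2
    · refine le_of_tendsto (P.tendsto_H (subset_closure hzΩ) (Eventually.of_forall hy) hyt hqt') ?_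
      filter_upwards [hyt.eventually hUΩ] with k hk
      exact (hvb _ ⟨hk.1, hy k⟩ _ (hq' k)).1 hk.2
  rintro z ⟨hzU, hzc⟩
  rcases mem_or_mem_frontier hzc with hzΩ | hzf
  · exact fun p hp => ⟨fun _ => hint z hzU hzΩ p hp, fun h => absurd h (P.notMem_frontier hzΩ)⟩
  obtain ⟨ρ, hρ, hκ⟩ := P.chart z hzf
  have hw : LocallyLipschitzOn (closure Ω) fun x => (u x + v x) / 2 := by
    refine locallyLipschitzOn_of_closedBall fun z hz => ?_
    obtain ⟨R, hR, K, hK0, hK⟩ := exists_lipschitz_closedBall (hu.add hv) hz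
    exact ⟨R, hR, K / 2, by positivity, fun x hx y hy => by linarith [hK x hx y hy]⟩
  -- Only the tangential form can be averaged: both of its inequalities are convex, and the
  -- parameters s and t average to (s + t)/2.
  refine P.subAt_of_exists_smul hzf hρ hκ hw ?_ fun p hp => ?_
  · filter_upwards [hU.mem_nhds hzU] with x hx using hint x hx
  obtain ⟨x, y, q, q', q₀, q₀', hx, hy, hxt, hyt, hq, hq', hqt, hqt', rfl⟩ :=
    exists_seq_superdiff_half_add isClosed_frontier hzf (hu.mono frontier_subset_closure)
      (hv.mono frontier_subset_closure) hp
  have hκev : ∀ᶠ x in 𝓝[frontier Ω] z, 0 < inner ℝ (gradient ρ x) (γ x) :=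
    ((hρ.c1At.continuousAt_gradient.tendsto.mono_left nhdsWithin_le_nhds).inner
      (P.continuousOn_γ z hzf)).eventually_const_lt hκ
  have hloc : ∀ {x : ℕ → E}, (∀ k, x k ∈ frontier Ω) → Tendsto x atTop (𝓝 z) →
      ∀ᶠ k in atTop, IsChart Ω ρ (x k) ∧ 0 < inner ℝ (gradient ρ (x k)) (γ (x k)) ∧ x k ∈ U :=
    fun hx hxt => (hxt.eventually hρ.eventually_isChart).and
      (((tendsto_nhdsWithin_iff.2 ⟨hxt, Eventually.of_forall hx⟩).eventually hκev).and
      (hxt.eventually (hU.mem_nhds hzU)))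
  obtain ⟨s, hs, hsg⟩ := P.exists_smul_of_tendsto hzf hρ (a := a) hx hxt hqt (by
    filter_upwards [hloc hx hxt] with k ⟨h1, h2, h3⟩
    refine P.exists_smul_of_subAt (hx k) h1 h2 hu ?_ (hua _ ⟨h3, (hx k).1⟩) (hq k)
    filter_upwards [hU.mem_nhds h3] with y hy hyΩ r hr
    exact (hua y ⟨hy, subset_closure hyΩ⟩ r hr).1 hyΩ)
  obtain ⟨t, ht, htg⟩ := P.exists_smul_of_tendsto hzf hρ (a := b) hy hyt hqt' (by
    filter_upwards [hloc hy hyt] with k ⟨h1, h2, h3⟩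
    refine P.exists_smul_of_subAt (hy k) h1 h2 hv ?_ (hvb _ ⟨h3, (hy k).1⟩) (hq' k)
    filter_upwards [hU.mem_nhds h3] with y hy hyΩ r hr
    exact (hvb y ⟨hy, subset_closure hyΩ⟩ r hr).1 hyΩ)
  have e : (1 / 2 : ℝ) • (q₀ + q₀') + ((s + t) / 2) • gradient ρ z =
      (1 / 2 : ℝ) • ((q₀ + s • gradient ρ z) + (q₀' + t • gradient ρ z)) := by module
  refine ⟨(s + t) / 2, ?_, ?_⟩
  · rw [e]
    exact hconv z hzc _ _ hs ht
  · rw [e, inner_smul_right, inner_add_right]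
    linarith

/-- The continuous subsolutions at the level `a`. -/
def subsolutions (_ : NeumannProblem Ω H γ g) (a : ℝ) : Set (E → ℝ) :=
  {v | ContinuousOn v (closure Ω) ∧ ∀ x ∈ closure Ω, SubAt Ω H γ g a v x}

theorem subAt_mono {u : E → ℝ} {x : E} {a b : ℝ} (hab : a ≤ b) (h : SubAt Ω H γ g a u x) :
    SubAt Ω H γ g b u x := fun p hp =>
  ⟨fun hx => ((h p hp).1 hx).trans hab, fun hx => ((h p hp).2 hx).imp_left fun h' => h'.trans hab⟩

theorem subsolutions_mono (P : NeumannProblem Ω H γ g) {a b : ℝ} (hab : a ≤ b) :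
    P.subsolutions a ⊆ P.subsolutions b :=
  fun _ hv => ⟨hv.1, fun x hx => subAt_mono hab (hv.2 x hx)⟩

theorem locallyLipschitzOn (P : NeumannProblem Ω H γ g) {a : ℝ} {v : E → ℝ}
    (hv : v ∈ P.subsolutions a) : LocallyLipschitzOn (closure Ω) v :=
  locallyLipschitzOn_of_closedBall fun z hz => by
    obtain ⟨R, hR, K, hK, h⟩ := P.exists_local_lipschitz a hz
    exact ⟨R, hR, K, hK, h v hv.1.upperSemicontinuousOn hv.2⟩

theorem half_add_mem (P : NeumannProblem Ω H γ g) {u v : E → ℝ} {a : ℝ}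
    (hu : u ∈ P.subsolutions a) (hv : v ∈ P.subsolutions a) :
    (fun x => (u x + v x) / 2) ∈ P.subsolutions a := by
  refine ⟨(hu.1.add hv.1).div_const 2, fun x hx => ?_⟩
  have h := P.subAt_half_add (P.locallyLipschitzOn hu) (P.locallyLipschitzOn hv) isOpen_univ
    (fun x hx => hu.2 x hx.2) (fun x hx => hv.2 x hx.2) x ⟨mem_univ x, hx⟩
  rwa [add_self_div_two] at h

/-- Functions approximated by subsolutions are subsolutions. -/
theorem subAt_of_approx (P : NeumannProblem Ω H γ g) {a : ℝ} {u : E → ℝ} {z : E}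
    (hz : z ∈ closure Ω) (h : ∀ η > 0, ∃ v ∈ P.subsolutions (a + η),
      (∀ x ∈ closure Ω, v x ≤ u x + η) ∧ u z - η ≤ v z) : SubAt Ω H γ g a u z := by
  intro p hp
  have hstep : ∀ k : ℕ, ∃ x ∈ closure Ω, dist x z < 1 / ((k : ℝ) + 1) ∧ ∃ q,
      dist q p < 1 / ((k : ℝ) + 1) ∧ (x ∈ Ω → H x q ≤ a + 1 / ((k : ℝ) + 1)) ∧
      (x ∈ frontier Ω → H x q ≤ a + 1 / ((k : ℝ) + 1) ∨ inner ℝ (γ x) q ≤ g x) := by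
    intro k
    have hk : (0 : ℝ) < 1 / ((k : ℝ) + 1) := Nat.one_div_pos_of_nat
    obtain ⟨η, hη, h1⟩ := exists_superdiff_near isClosed_closure hz hp hk
    obtain ⟨v, hv, hv1, hv2⟩ := h (min η (1 / ((k : ℝ) + 1))) (lt_min hη hk)
    obtain ⟨x, hx, hxz, q, hq, hqp⟩ := h1 v hv.1
      (fun x hx => (hv1 x hx).trans (by linarith [min_le_left η (1 / ((k : ℝ) + 1))]))
      (le_trans (by linarith [min_le_left η (1 / ((k : ℝ) + 1))]) hv2)
    exact ⟨x, hx, hxz, q, by rwa [dist_eq_norm],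
      subAt_mono (by linarith [min_le_right η (1 / ((k : ℝ) + 1))]) (hv.2 x hx) q hq⟩
  choose x hx hxz q hqp hΩ hf using hstep
  have hxt := tendsto_of_dist_lt_one_div hxz
  have hqt := tendsto_of_dist_lt_one_div hqp
  have hHt := P.tendsto_H hz (Eventually.of_forall hx) hxt hqt
  have hat : Tendsto (fun k : ℕ => a + 1 / ((k : ℝ) + 1)) atTop (𝓝 a) := by
    simpa using tendsto_one_div_add_atTop_nhds_zero_nat.const_add a
  constructor
  · intro hzΩ
    refine le_of_tendsto_of_tendsto hHt hat ?_
    filter_upwards [hxt.eventually (P.isOpen.mem_nhds hzΩ)] with k hk using hΩ k hk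
  · intro hzf
    -- Either the inequality on H holds infinitely often and passes to the limit, or the points are
    -- eventually on the boundary with the other alternative.
    by_cases hfr : ∃ᶠ k in atTop, H (x k) (q k) ≤ a + 1 / ((k : ℝ) + 1)
    · exact Or.inl (le_of_tendsto_of_tendsto_of_frequently hHt hat hfr)
    · right
      obtain ⟨N, hN⟩ := eventually_atTop.1 (not_frequently.1 hfr)
      have hxf : ∀ k, x (k + N) ∈ frontier Ω := fun k =>
        (mem_or_mem_frontier (hx _)).resolve_left fun h' =>
          hN (k + N) (Nat.le_add_left N k) (hΩ _ h')
      obtain ⟨h1, h2⟩ := P.tendsto_inner hzf hxf (hxt.comp (tendsto_add_atTop_nat N))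
        (hqt.comp (tendsto_add_atTop_nat N))
      exact le_of_tendsto_of_tendsto' h1 h2 fun k =>
        (hf _ (hxf k)).resolve_left (hN (k + N) (Nat.le_add_left N k))

/-- The oscillation of subsolutions between two points is bounded uniformly. -/
theorem exists_sub_le (P : NeumannProblem Ω H γ g) (a : ℝ) {x y : E} (hx : x ∈ closure Ω)
    (hy : y ∈ closure Ω) : ∃ C, ∀ v ∈ P.subsolutions a, |v x - v y| ≤ C := by
  refine P.isConnected.isPreconnected.closure.induction₂
    (fun x y => ∃ C, ∀ v ∈ P.subsolutions a, |v x - v y| ≤ C) (fun z hz => ?_) ?_ ?_ hx hy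
  · obtain ⟨R, hR, K, hK, h⟩ := P.exists_local_lipschitz a hz
    filter_upwards [self_mem_nhdsWithin, mem_nhdsWithin_of_mem_nhds
      (Metric.closedBall_mem_nhds z hR)] with y hy hyR
    refine ⟨K * ‖z - y‖, fun v hv => abs_le.2 ⟨?_, ?_⟩⟩
    · have := h v hv.1.upperSemicontinuousOn hv.2 y ⟨hy, hyR⟩ z
        ⟨hz, Metric.mem_closedBall_self hR.le⟩
      rw [norm_sub_rev] at this
      linarith
    · exact h v hv.1.upperSemicontinuousOn hv.2 z ⟨hz, Metric.mem_closedBall_self hR.le⟩ y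
        ⟨hy, hyR⟩
  · rintro x y z - - - ⟨C, hC⟩ ⟨C', hC'⟩
    exact ⟨C + C', fun v hv => (abs_sub_le _ (v y) _).trans (add_le_add (hC v hv) (hC' v hv))⟩
  · rintro x y - - ⟨C, hC⟩
    exact ⟨C, fun v hv => by rw [abs_sub_comm]; exact hC v hv⟩

/-- The maximal subsolution at the level `a` vanishing at `y`. -/
noncomputable def maxSub (P : NeumannProblem Ω H γ g) (a : ℝ) (y x : E) : ℝ :=
  sSup ((fun v : E → ℝ => v x - v y) '' P.subsolutions a)

theorem sub_le_maxSub (P : NeumannProblem Ω H γ g) {a : ℝ} {x y : E} (hx : x ∈ closure Ω)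
    (hy : y ∈ closure Ω) {v : E → ℝ} (hv : v ∈ P.subsolutions a) :
    v x - v y ≤ P.maxSub a y x := by
  obtain ⟨C, hC⟩ := P.exists_sub_le a hx hy
  refine le_csSup ⟨C, ?_⟩ (mem_image_of_mem (fun v : E → ℝ => v x - v y) hv)
  rintro _ ⟨w, hw, rfl⟩
  exact (le_abs_self _).trans (hC w hw)

theorem maxSub_le (P : NeumannProblem Ω H γ g) {a : ℝ} (hne : (P.subsolutions a).Nonempty)
    {x y : E} {C : ℝ} (h : ∀ v ∈ P.subsolutions a, v x - v y ≤ C) : P.maxSub a y x ≤ C := by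
  refine csSup_le (hne.image _) ?_
  rintro _ ⟨w, hw, rfl⟩
  exact h w hw

theorem exists_lt_maxSub (P : NeumannProblem Ω H γ g) {a : ℝ} (hne : (P.subsolutions a).Nonempty)
    {x y : E} {C : ℝ} (h : C < P.maxSub a y x) : ∃ v ∈ P.subsolutions a, C < v x - v y := by
  obtain ⟨_, ⟨v, hv, rfl⟩, h'⟩ := exists_lt_of_lt_csSup (hne.image _) h
  exact ⟨v, hv, h'⟩

theorem maxSub_self (P : NeumannProblem Ω H γ g) {a : ℝ} (hne : (P.subsolutions a).Nonempty)
    (y : E) : P.maxSub a y y = 0 := by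
  rw [maxSub]
  simp [hne.image_const]

theorem maxSub_sub_le (P : NeumannProblem Ω H γ g) {a : ℝ} (hne : (P.subsolutions a).Nonempty)
    {x x' y : E} (hx' : x' ∈ closure Ω) (hy : y ∈ closure Ω) {C : ℝ}
    (h : ∀ v ∈ P.subsolutions a, v x - v x' ≤ C) :
    P.maxSub a y x - P.maxSub a y x' ≤ C := by
  rw [sub_le_iff_le_add]
  refine P.maxSub_le hne fun v hv => ?_
  linarith [h v hv, P.sub_le_maxSub hx' hy hv]

theorem locallyLipschitzOn_maxSub (P : NeumannProblem Ω H γ g) {a : ℝ}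
    (hne : (P.subsolutions a).Nonempty) {y : E} (hy : y ∈ closure Ω) :
    LocallyLipschitzOn (closure Ω) (P.maxSub a y) :=
  locallyLipschitzOn_of_closedBall fun z hz => by
    obtain ⟨R, hR, K, hK, h⟩ := P.exists_local_lipschitz a hz
    exact ⟨R, hR, K, hK, fun x hx x' hx' => P.maxSub_sub_le hne hx'.1 hy fun v hv =>
      h v hv.1.upperSemicontinuousOn hv.2 x hx x' hx'⟩

theorem add_const_mem (P : NeumannProblem Ω H γ g) {a : ℝ} {v : E → ℝ}
    (hv : v ∈ P.subsolutions a) (c : ℝ) : (fun x => v x + c) ∈ P.subsolutions a :=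
  ⟨hv.1.add continuousOn_const, fun x hx p hp => hv.2 x hx p (superdiff_add_const c hp)⟩

/-- A nearly optimal v for z, translated to vanish at y, lies below the supremum everywhere and
almost touches it at z; this one-sided approximation is all that `subAt_of_approx` needs. -/
theorem maxSub_mem (P : NeumannProblem Ω H γ g) {a : ℝ} (hne : (P.subsolutions a).Nonempty)
    {y : E} (hy : y ∈ closure Ω) : P.maxSub a y ∈ P.subsolutions a := by
  refine ⟨(P.locallyLipschitzOn_maxSub hne hy).continuousOn, fun z hz =>
    P.subAt_of_approx hz fun η hη => ?_⟩
  obtain ⟨v, hv, hlt⟩ := P.exists_lt_maxSub hne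
    (show P.maxSub a y z - η < P.maxSub a y z by linarith)
  refine ⟨fun x => v x + -v y, P.add_const_mem (P.subsolutions_mono (by linarith) hv) _,
    fun x hx => ?_, by linarith⟩
  linarith [P.sub_le_maxSub hx hy hv]

/-- Subsolutions exist at the critical level. -/
theorem subsolutions_zero_nonempty (P : NeumannProblem Ω H γ g)
    (h : ∀ a > 0, (P.subsolutions a).Nonempty) : (P.subsolutions 0).Nonempty := by
  obtain ⟨y, hyΩ⟩ := P.isConnected.nonempty
  have hy : y ∈ closure Ω := subset_closure hyΩ
  set α : ℕ → ℝ := fun k => 1 / ((k : ℝ) + 1) with hα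
  have hα0 : ∀ k, 0 < α k := fun k => Nat.one_div_pos_of_nat
  have hαanti : Antitone α := fun i j hij => one_div_le_one_div_of_le (by positivity) (by gcongr)
  have hα1 : ∀ k, α k ≤ 1 := fun k => by simpa [hα] using hαanti (Nat.zero_le k)
  set F : ℕ → E → ℝ := fun k => P.maxSub (α k) y with hF
  have hne : ∀ k, (P.subsolutions (α k)).Nonempty := fun k => h _ (hα0 k)
  have hFmem : ∀ k, F k ∈ P.subsolutions (α k) := fun k => P.maxSub_mem (hne k) hy
  have hFmem1 : ∀ k, F k ∈ P.subsolutions 1 := fun k => P.subsolutions_mono (hα1 k) (hFmem k)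
  have hFy : ∀ k, F k y = 0 := fun k => P.maxSub_self (hne k) y
  have hFanti : ∀ x ∈ closure Ω, Antitone fun k => F k x := fun x hx i j hij =>
    P.maxSub_le (hne j) fun v hv =>
      P.sub_le_maxSub hx hy (P.subsolutions_mono (hαanti hij) hv)
  have hFt : ∀ x ∈ closure Ω, Tendsto (fun k => F k x) atTop (𝓝 (⨅ k, F k x)) := by
    intro x hx
    refine tendsto_atTop_ciInf (hFanti x hx) ?_
    obtain ⟨C, hC⟩ := P.exists_sub_le 1 hx hy
    refine ⟨-C, ?_⟩
    rintro _ ⟨k, rfl⟩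
    have := (abs_le.1 (hC _ (hFmem1 k))).1
    rw [hFy] at this
    simpa using this
  set f : E → ℝ := fun x => ⨅ k, F k x with hf
  have hfc : ContinuousOn f (closure Ω) := by
    refine LocallyLipschitzOn.continuousOn (locallyLipschitzOn_of_closedBall fun z hz => ?_)
    obtain ⟨R, hR, K, hK, hKv⟩ := P.exists_local_lipschitz 1 hz
    exact ⟨R, hR, K, hK, fun x hx x' hx' => le_of_tendsto ((hFt x hx.1).sub (hFt x' hx'.1))
      (Eventually.of_forall fun k => hKv _ (hFmem1 k).1.upperSemicontinuousOn (hFmem1 k).2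
        x hx x' hx')⟩
  have hunif := Antitone.tendstoUniformlyOn_of_forall_tendsto P.isCompact_closure
    (fun k => (hFmem k).1) hFanti hfc hFt
  refine ⟨f, hfc, fun z hz => P.subAt_of_approx hz fun η hη => ?_⟩
  obtain ⟨k, hk1, hk2⟩ := ((Metric.tendstoUniformlyOn_iff.1 hunif η hη).and
    ((tendsto_one_div_add_atTop_nhds_zero_nat (𝕜 := ℝ)).eventually_lt_const hη)).exists
  have hk : ∀ x ∈ closure Ω, |f x - F k x| < η := fun x hx => by
    simpa [Real.dist_eq] using hk1 x hx
  exact ⟨F k, P.subsolutions_mono (by rw [zero_add]; exact hk2.le) (hFmem k),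
    fun x hx => by linarith [(abs_lt.1 (hk x hx)).1], by linarith [(abs_lt.1 (hk z hz)).2]⟩

/-- Perron's method: if `u` fails to be a supersolution at `x₀`, it can be increased there, to a
subsolution that is strict near `x₀`. -/
theorem exists_bump (P : NeumannProblem Ω H γ g) {u φ : E → ℝ} {x₀ p : E}
    (hu : u ∈ P.subsolutions 0) (hx₀ : x₀ ∈ closure Ω) (hφ : C1At φ p x₀)
    (hmin : IsLocalMinOn (fun y => u y - φ y) (closure Ω) x₀) (hH : H x₀ p < 0)
    (hg : x₀ ∈ frontier Ω → inner ℝ (γ x₀) p < g x₀) {r₀ : ℝ} (hr₀ : 0 < r₀) :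
    ∃ w ∈ P.subsolutions 0, u x₀ < w x₀ ∧ (∀ x, r₀ ≤ dist x x₀ → w x = u x) ∧
      ∃ ε > 0, ∃ r > 0, ∀ x ∈ closure Ω ∩ Metric.ball x₀ r, SubAt Ω H γ g (-ε) w x := by
  set ε := -H x₀ p / 2 with hε
  have hε0 : 0 < ε := by linarith
  set G : E → E := fun x => gradient φ x - (2 : ℝ) • (x - x₀) with hG
  have hGc : Tendsto G (𝓝 x₀) (𝓝 p) := by
    have h1 : ContinuousAt G x₀ := hφ.continuousAt_gradient.sub (by fun_prop)
    have h2 : G x₀ = p := by simp [hG, hφ.gradient_eq]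
    rw [← h2]
    exact h1
  have hH' : ∀ᶠ x in 𝓝[closure Ω] x₀, H x (G x) < -ε :=
    (P.tendsto_H hx₀ eventually_mem_nhdsWithin (tendsto_id.mono_left nhdsWithin_le_nhds)
      (hGc.mono_left nhdsWithin_le_nhds)).eventually_lt_const (by linarith)
  have hg' : ∀ᶠ x in 𝓝[closure Ω] x₀, x ∈ frontier Ω → inner ℝ (γ x) (G x) ≤ g x := by
    refine nhdsWithin_le_nhds ?_
    by_cases hf : x₀ ∈ frontier Ω
    · refine eventually_nhdsWithin_iff.1 ?_
      have h1 : Tendsto (fun x => inner ℝ (γ x) (G x)) (𝓝[frontier Ω] x₀) (𝓝 (inner ℝ (γ x₀) p)) :=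
        (P.continuousOn_γ x₀ hf).tendsto.inner (hGc.mono_left nhdsWithin_le_nhds)
      filter_upwards [h1.eventually_lt (P.continuousOn_g x₀ hf).tendsto (hg hf)] with x hx
        using hx.le
    · filter_upwards [isClosed_frontier.isOpen_compl.mem_nhds hf] with x hx hx'
      exact absurd hx' hx
  obtain ⟨r1, hr1, h1⟩ := exists_closedBall_of_eventually hφ.eventually
  obtain ⟨r2, hr2, h2⟩ := exists_closedBall_of_eventually_within (hmin.and (hH'.and hg'))
  obtain ⟨r, hr, hrr₀, hrr1, hrr2⟩ : ∃ r > 0, r ≤ r₀ ∧ r ≤ r1 ∧ r ≤ r2 :=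
    ⟨min r₀ (min r1 r2), by positivity, min_le_left _ _,
      (min_le_right _ _).trans (min_le_left _ _), (min_le_right _ _).trans (min_le_right _ _)⟩
  -- ψ exceeds u by (r/2)² at x₀ and is at most u once the distance to x₀ reaches r/2, so max(u, ψ)
  -- glues continuously to u.
  set ψ : E → ℝ := fun x => φ x - ‖x - x₀‖ ^ 2 + (u x₀ - φ x₀ + (r / 2) ^ 2) with hψ
  have hψC : ∀ x, dist x x₀ < r → C1At ψ (G x) x := fun x hx =>
    ((h1 x (Metric.mem_closedBall.2 (hx.le.trans hrr1))).sub (C1At.norm_sub_sq x₀ x)).add_const _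
  have hψu : ∀ x ∈ closure Ω, dist x x₀ < r → r / 2 ≤ dist x x₀ → ψ x ≤ u x := by
    intro x hx hxr hxr'
    have e1 : u x₀ - φ x₀ ≤ u x - φ x :=
      (h2 x ⟨hx, Metric.mem_closedBall.2 (hxr.le.trans hrr2)⟩).1
    rw [dist_eq_norm] at hxr'
    have e2 := pow_le_pow_left₀ (by positivity) hxr' 2
    simp only [hψ]
    linarith
  have hψ0 : u x₀ < ψ x₀ := by
    have : 0 < (r / 2) ^ 2 := by positivity
    simp only [hψ, sub_self, norm_zero]
    linarith
  classical
  set w : E → ℝ := fun x => if dist x x₀ < r then max (u x) (ψ x) else u x with hw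
  have hw1 : ∀ x, dist x x₀ < r → w x = max (u x) (ψ x) := fun x hx => if_pos hx
  have hw2 : ∀ x, r ≤ dist x x₀ → w x = u x := fun x hx => if_neg (not_lt.2 hx)
  have hwu : ∀ x, u x ≤ w x := fun x => by
    by_cases hx : dist x x₀ < r
    · rw [hw1 x hx]
      exact le_max_left _ _
    · rw [hw2 x (not_lt.1 hx)]
  have hw3 : ∀ x ∈ closure Ω, r / 2 < dist x x₀ → w x = u x := fun x hx hx' => by
    by_cases hxr : dist x x₀ < r
    · rw [hw1 x hxr, max_eq_left (hψu x hx hxr hx'.le)]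
    · exact hw2 x (not_lt.1 hxr)
  have hballn : ∀ x, dist x x₀ < r → ∀ᶠ y in 𝓝 x, dist y x₀ < r := fun x hx =>
    (isOpen_lt (continuous_id.dist continuous_const) continuous_const).mem_nhds hx
  have hwc : ContinuousOn w (closure Ω) := by
    intro x hx
    by_cases hxr : dist x x₀ < r
    · have hc : ContinuousWithinAt (fun y => max (u y) (ψ y)) (closure Ω) x :=
        (hu.1 x hx).max (hψC x hxr).continuousAt.continuousWithinAt
      refine hc.congr_of_eventuallyEq ?_ (hw1 x hxr)
      filter_upwards [nhdsWithin_le_nhds (hballn x hxr)] with y hy using hw1 y hy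
    · have hxr' : r / 2 < dist x x₀ := by linarith
      have hopen : ∀ᶠ y in 𝓝 x, r / 2 < dist y x₀ :=
        (isOpen_lt continuous_const (continuous_id.dist continuous_const)).mem_nhds hxr'
      refine (hu.1 x hx).congr_of_eventuallyEq ?_ (hw3 x hx hxr')
      filter_upwards [nhdsWithin_le_nhds hopen, self_mem_nhdsWithin] with y hy hy'
        using hw3 y hy' hy
  -- Where ψ > u, w touches ψ from above, so superdifferentials of w are superdifferentials of the
  -- strict C¹ subsolution ψ.
  have hstrict : ∀ x ∈ closure Ω, dist x x₀ < r → u x < ψ x → SubAt Ω H γ g (-ε) w x := by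
    intro x hx hxr hux q hq
    have hq' : q ∈ superdiff (closure Ω) ψ x := by
      refine superdiff_subset_of_eventuallyEq ?_ ?_ hq
      · filter_upwards [nhdsWithin_le_nhds (hballn x hxr)] with y hy
        rw [hw1 y hy]
        exact le_max_right _ _
      · rw [hw1 x hxr, max_eq_right hux.le]
    obtain ⟨-, h3, h4⟩ := h2 x ⟨hx, Metric.mem_closedBall.2 (hxr.le.trans hrr2)⟩
    refine ⟨fun hxΩ => ?_, fun hxf => Or.inr ?_⟩
    · rw [superdiff_subset_of_c1At P.isOpen (hψC x hxr) hq' hxΩ]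
      exact h3.le
    · obtain ⟨ρ, hρ, hκ⟩ := P.chart x hxf
      exact (hρ.inner_le_of_c1At hxf hκ (hψC x hxr) hq').trans (h4 hxf)
  refine ⟨w, ⟨hwc, fun x hx => ?_⟩, ?_, fun x hx => hw2 x (hrr₀.trans hx), ε, hε0, ?_⟩
  · by_cases hcase : dist x x₀ < r ∧ u x < ψ x
    · exact subAt_mono (by linarith) (hstrict x hx hcase.1 hcase.2)
    · have hwx : u x = w x := by
        by_cases hxr : dist x x₀ < r
        · rw [hw1 x hxr, max_eq_left (not_lt.1 fun h' => hcase ⟨hxr, h'⟩)]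
        · exact (hw2 x (not_lt.1 hxr)).symm
      exact fun q hq => hu.2 x hx q
        (superdiff_subset_of_eventuallyEq (Eventually.of_forall hwu) hwx hq)
  · rw [hw1 x₀ (by simpa using hr)]
    exact hψ0.trans_le (le_max_right _ _)
  · have hψx₀ : ContinuousAt ψ x₀ := (hψC x₀ (by simpa using hr)).continuousAt
    have hev : ∀ᶠ x in 𝓝[closure Ω] x₀, u x < ψ x ∧ dist x x₀ < r :=
      ((hu.1 x₀ hx₀).eventually_lt hψx₀.continuousWithinAt hψ0).and
        (nhdsWithin_le_nhds (hballn x₀ (by simpa using hr)))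
    obtain ⟨s, hs, hs'⟩ := exists_closedBall_of_eventually_within hev
    refine ⟨s, hs, fun x hx => ?_⟩
    have h5 := hs' x ⟨hx.1, Metric.ball_subset_closedBall hx.2⟩
    exact hstrict x hx.1 h5.2 h5.1

end NeumannProblem

end Subsolutions


/-! ### The supersolution test and strict subsolutions -/

section Supersolutions

variable {E : Type*} [NormedAddCommGroup E] [InnerProductSpace ℝ E] [FiniteDimensional ℝ E]

/-- The conditions on the subdifferential of a supersolution at the level `0`, at `x`. -/
def SuperAt (Ω : Set E) (H : E → E → ℝ) (γ : E → E) (g : E → ℝ) (u : E → ℝ) (x : E) : Prop :=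
  ∀ p ∈ superdiff (closure Ω) (fun y => -u y) x, (x ∈ Ω → 0 ≤ H x (-p)) ∧
    (x ∈ frontier Ω → 0 ≤ H x (-p) ∨ g x ≤ inner ℝ (γ x) (-p))

namespace NeumannProblem

variable {Ω : Set E} {H : E → E → ℝ} {γ : E → E} {g : E → ℝ}

theorem superAt_congr {u v : E → ℝ} (h : EqOn u v (closure Ω)) {x : E} (hx : x ∈ closure Ω)
    (hu : SuperAt Ω H γ g u x) : SuperAt Ω H γ g v x := fun p hp =>
  hu p (superdiff_subset_of_eventuallyEq
    (by filter_upwards [self_mem_nhdsWithin] with y hy using (neg_le_neg (h hy).ge))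
    (by rw [h hx]) hp)

theorem exists_bump_of_not_superAt (P : NeumannProblem Ω H γ g) {u : E → ℝ} {x₀ : E}
    (hu : u ∈ P.subsolutions 0) (hx₀ : x₀ ∈ closure Ω) (h : ¬ SuperAt Ω H γ g u x₀) {r₀ : ℝ}
    (hr₀ : 0 < r₀) :
    ∃ w ∈ P.subsolutions 0, u x₀ < w x₀ ∧ (∀ x, r₀ ≤ dist x x₀ → w x = u x) ∧
      ∃ ε > 0, ∃ r > 0, ∀ x ∈ closure Ω ∩ Metric.ball x₀ r, SubAt Ω H γ g (-ε) w x := by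
  simp only [SuperAt, not_forall] at h
  obtain ⟨p, ⟨φ, hφ, hmax⟩, hp⟩ := h
  have hφ' : C1At (fun y => -φ y) (-p) x₀ := by simpa using hφ.const_mul (-1)
  have hmin : IsLocalMinOn (fun y => u y - -φ y) (closure Ω) x₀ := by
    filter_upwards [hmax] with y hy
    linarith
  have hH : H x₀ (-p) < 0 := by
    by_contra! hcon
    exact hp ⟨fun _ => hcon, fun _ => Or.inl hcon⟩
  refine P.exists_bump hu hx₀ hφ' hmin hH (fun hf => ?_) hr₀
  by_contra! hcon
  exact hp ⟨fun hΩ => absurd hf (P.notMem_frontier hΩ), fun _ => Or.inr hcon⟩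

/-- Away from `y`, the maximal subsolution vanishing at `y` is a supersolution. -/
theorem superAt_maxSub_of_ne (P : NeumannProblem Ω H γ g) (hne : (P.subsolutions 0).Nonempty)
    {x y : E} (hx : x ∈ closure Ω) (hy : y ∈ closure Ω) (hxy : x ≠ y) :
    SuperAt Ω H γ g (P.maxSub 0 y) x := by
  by_contra hcon
  -- With radius `dist x y` the bump leaves the value 0 at y unchanged, so w would beat the supremum
  -- at x.
  obtain ⟨w, hw, hlt, hfar, -⟩ := P.exists_bump_of_not_superAt (P.maxSub_mem hne hy) hx hcon
    (dist_pos.2 hxy)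
  have h1 := hfar y (dist_comm x y).le
  rw [P.maxSub_self hne] at h1
  have h2 := P.sub_le_maxSub hx hy hw
  linarith

theorem maxSub_triangle (P : NeumannProblem Ω H γ g) (hne : (P.subsolutions 0).Nonempty)
    {x y z : E} (hx : x ∈ closure Ω) (hy : y ∈ closure Ω) (hz : z ∈ closure Ω) :
    P.maxSub 0 y x ≤ P.maxSub 0 z x + P.maxSub 0 y z :=
  P.maxSub_le hne fun v hv => by
    linarith [P.sub_le_maxSub hx hz hv, P.sub_le_maxSub hz hy hv]

/-- By the triangle inequality d(·, y_k) and d(·, z) differ by at most the larger of d(y_k, z) and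
d(z, y_k), which tend to 0 by the Lipschitz bound. The rest is stability under uniform convergence.
-/
theorem superAt_of_tendsto (P : NeumannProblem Ω H γ g) (hne : (P.subsolutions 0).Nonempty)
    {y : ℕ → E} {z : E} (hy : ∀ k, y k ∈ closure Ω) (hyz : Tendsto y atTop (𝓝 z))
    (h : ∀ k, ∀ x ∈ closure Ω, SuperAt Ω H γ g (P.maxSub 0 (y k)) x) :
    SuperAt Ω H γ g (P.maxSub 0 z) z := by
  have hz : z ∈ closure Ω := isClosed_closure.mem_of_tendsto hyz (Eventually.of_forall hy)
  obtain ⟨R, hR, K, hK, hKv⟩ := P.exists_local_lipschitz 0 hz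
  have hzR : z ∈ closure Ω ∩ Metric.closedBall z R := ⟨hz, Metric.mem_closedBall_self hR.le⟩
  have hunif : ∀ η > 0, ∃ k, ∀ x ∈ closure Ω, |P.maxSub 0 (y k) x - P.maxSub 0 z x| ≤ η := by
    intro η hη
    have hlim : Tendsto (fun k => K * ‖y k - z‖) atTop (𝓝 0) := by
      simpa using ((hyz.sub_const z).norm).const_mul K
    obtain ⟨k, h1, h2⟩ := ((hlim.eventually_lt_const hη).and
      (hyz.eventually (Metric.closedBall_mem_nhds z hR))).exists
    refine ⟨k, fun x hx => abs_le.2 ⟨?_, ?_⟩⟩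
    · have e1 := P.maxSub_triangle hne hx hz (hy k)
      have e2 : P.maxSub 0 z (y k) ≤ K * ‖y k - z‖ := P.maxSub_le hne fun v hv =>
        hKv v hv.1.upperSemicontinuousOn hv.2 _ ⟨hy k, h2⟩ _ hzR
      linarith
    · have e1 := P.maxSub_triangle hne hx (hy k) hz
      have e2 : P.maxSub 0 (y k) z ≤ K * ‖z - y k‖ := P.maxSub_le hne fun v hv =>
        hKv v hv.1.upperSemicontinuousOn hv.2 _ hzR _ ⟨hy k, h2⟩
      rw [norm_sub_rev] at e2
      linarith
  intro p hp
  have hstep : ∀ j : ℕ, ∃ x ∈ closure Ω, dist x z < 1 / ((j : ℝ) + 1) ∧ ∃ q,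
      dist q p < 1 / ((j : ℝ) + 1) ∧ (x ∈ Ω → 0 ≤ H x (-q)) ∧
      (x ∈ frontier Ω → 0 ≤ H x (-q) ∨ g x ≤ inner ℝ (γ x) (-q)) := by
    intro j
    obtain ⟨η, hη, h1⟩ := exists_superdiff_near isClosed_closure hz hp
      (Nat.one_div_pos_of_nat : (0 : ℝ) < 1 / ((j : ℝ) + 1))
    obtain ⟨k, hk⟩ := hunif η hη
    obtain ⟨x, hx, hxz, q, hq, hqp⟩ := h1 (fun x => -P.maxSub 0 (y k) x)
      (P.maxSub_mem hne (hy k)).1.neg (fun x hx => by linarith [(abs_le.1 (hk x hx)).1])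
      (by linarith [(abs_le.1 (hk z hz)).2])
    exact ⟨x, hx, hxz, q, by rwa [dist_eq_norm], h k x hx q hq⟩
  choose x hx hxz q hqp hΩ hf using hstep
  have hxt := tendsto_of_dist_lt_one_div hxz
  have hqt := (tendsto_of_dist_lt_one_div hqp).neg
  have hHt := P.tendsto_H hz (Eventually.of_forall hx) hxt hqt
  constructor
  · intro hzΩ
    refine ge_of_tendsto hHt ?_
    filter_upwards [hxt.eventually (P.isOpen.mem_nhds hzΩ)] with k hk using hΩ k hk
  · intro hzf
    by_cases hfr : ∃ᶠ k in atTop, 0 ≤ H (x k) (-q k)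
    · exact Or.inl (ge_of_tendsto_of_frequently hHt hfr)
    · right
      obtain ⟨N, hN⟩ := eventually_atTop.1 (not_frequently.1 hfr)
      have hxf : ∀ k, x (k + N) ∈ frontier Ω := fun k =>
        (mem_or_mem_frontier (hx _)).resolve_left fun h' =>
          hN (k + N) (Nat.le_add_left N k) (hΩ _ h')
      obtain ⟨h1, h2⟩ := P.tendsto_inner hzf hxf (hxt.comp (tendsto_add_atTop_nat N))
        (hqt.comp (tendsto_add_atTop_nat N))
      exact le_of_tendsto_of_tendsto' h2 h1 fun k =>
        (hf _ (hxf k)).resolve_left (hN (k + N) (Nat.le_add_left N k))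

/-- If no maximal subsolution `maxSub 0 y` is a supersolution at `y`, there is a subsolution at a
negative level. -/
theorem exists_neg_level (P : NeumannProblem Ω H γ g) (hne : (P.subsolutions 0).Nonempty)
    (h : ∀ y ∈ closure Ω, ¬ SuperAt Ω H γ g (P.maxSub 0 y) y) :
    ∃ ε > 0, (P.subsolutions (-ε)).Nonempty := by
  have key : ∃ w ∈ P.subsolutions 0, ∃ ε > 0, ∃ U, IsOpen U ∧ closure Ω ⊆ U ∧
      ∀ x ∈ U ∩ closure Ω, SubAt Ω H γ g (-ε) w x := by
    -- The property of S is that one global subsolution at level 0 is strict on a neighbourhood of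
    -- S; open U are needed because averaging uses the conditions at nearby points.
    refine P.isCompact_closure.induction_on (p := fun S => ∃ w ∈ P.subsolutions 0, ∃ ε > 0,
      ∃ U, IsOpen U ∧ S ⊆ U ∧ ∀ x ∈ U ∩ closure Ω, SubAt Ω H γ g (-ε) w x) ?_ ?_ ?_ ?_
    · obtain ⟨w, hw⟩ := hne
      exact ⟨w, hw, 1, one_pos, ∅, isOpen_empty, Subset.rfl, fun x hx => absurd hx.1 (by simp)⟩
    · rintro s t hst ⟨w, hw, ε, hε, U, hU, htU, hs⟩
      exact ⟨w, hw, ε, hε, U, hU, hst.trans htU, hs⟩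
    · rintro s t ⟨w, hw, ε, hε, U, hU, hsU, hs⟩ ⟨w', hw', ε', hε', U', hU', htU', ht⟩
      -- On U the levels -ε and 0 average to -ε/2, and on U' the levels 0 and -ε' to -ε'/2.
      refine ⟨_, P.half_add_mem hw hw', min ε ε' / 2, by positivity, U ∪ U', hU.union hU',
        union_subset_union hsU htU', ?_⟩
      have hl := P.locallyLipschitzOn hw
      have hl' := P.locallyLipschitzOn hw'
      rintro x ⟨hx | hx, hxc⟩
      · refine subAt_mono ?_ (P.subAt_half_add hl hl' hU hs (fun y hy => hw'.2 y hy.2) x ⟨hx, hxc⟩)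
        linarith [min_le_left ε ε']
      · refine subAt_mono ?_ (P.subAt_half_add hl hl' hU' (fun y hy => hw.2 y hy.2) ht x ⟨hx, hxc⟩)
        linarith [min_le_right ε ε']
    · intro y hy
      obtain ⟨w, hw, -, -, ε, hε, r, hr, hs⟩ :=
        P.exists_bump_of_not_superAt (P.maxSub_mem hne hy) hy (h y hy) one_pos
      exact ⟨Metric.ball y r, mem_nhdsWithin_of_mem_nhds (Metric.ball_mem_nhds y hr), w, hw, ε, hε,
        Metric.ball y r, Metric.isOpen_ball, Subset.rfl, fun x hx => hs x ⟨hx.2, hx.1⟩⟩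
  obtain ⟨w, hw, ε, hε, U, -, hU, hs⟩ := key
  exact ⟨ε, hε, w, hw.1, fun x hx => hs x ⟨hU hx, hx⟩⟩

end NeumannProblem

end Supersolutions

/-! ### Semicontinuous envelopes -/

section Envelopes

variable {n : ℕ} {Ω : Set (EuclideanSpace ℝ (Fin n))}

theorem neBot_nhdsWithin_closure {x : EuclideanSpace ℝ (Fin n)} (hx : x ∈ closure Ω) :
    (𝓝[closure Ω] x).NeBot :=
  mem_closure_iff_nhdsWithin_neBot.1 (subset_closure hx)

theorem upperEnvelope_eq {u : EuclideanSpace ℝ (Fin n) → ℝ} (hu : ContinuousOn u (closure Ω))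
    {x : EuclideanSpace ℝ (Fin n)} (hx : x ∈ closure Ω) : upperEnvelope Ω u x = u x :=
  haveI := neBot_nhdsWithin_closure hx
  (hu x hx).tendsto.limsup_eq

theorem lowerEnvelope_eq {u : EuclideanSpace ℝ (Fin n) → ℝ} (hu : ContinuousOn u (closure Ω))
    {x : EuclideanSpace ℝ (Fin n)} (hx : x ∈ closure Ω) : lowerEnvelope Ω u x = u x :=
  haveI := neBot_nhdsWithin_closure hx
  (hu x hx).tendsto.liminf_eq

theorem eventually_le_of_bddAbove {u : EuclideanSpace ℝ (Fin n) → ℝ} {C : ℝ}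
    (hC : ∀ y ∈ closure Ω, u y ≤ C) (x : EuclideanSpace ℝ (Fin n)) :
    ∀ᶠ y in 𝓝[closure Ω] x, u y ≤ C := by
  filter_upwards [self_mem_nhdsWithin] with y hy using hC y hy

/-- A real `limsup` is an `sInf`, meaningful only for sets bounded below. Here u(x) is such a bound,
since x belongs to each of its neighbourhoods in the closure. -/
theorem upperEnvelope_le {u : EuclideanSpace ℝ (Fin n) → ℝ} {x : EuclideanSpace ℝ (Fin n)}
    (hx : x ∈ closure Ω) {c : ℝ} (h : ∀ᶠ y in 𝓝[closure Ω] x, u y ≤ c) :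
    upperEnvelope Ω u x ≤ c := by
  refine csInf_le ⟨u x, fun b hb => ?_⟩ h
  have hb' : ∀ᶠ y in 𝓝[closure Ω] x, u y ≤ b := hb
  exact hb'.self_of_nhdsWithin hx

theorem eventually_lt_of_upperEnvelope_lt {u : EuclideanSpace ℝ (Fin n) → ℝ} {C : ℝ}
    (hC : ∀ y ∈ closure Ω, u y ≤ C) {x : EuclideanSpace ℝ (Fin n)} {c : ℝ}
    (h : upperEnvelope Ω u x < c) : ∀ᶠ y in 𝓝[closure Ω] x, u y < c :=
  eventually_lt_of_limsup_lt h (isBoundedUnder_of_eventually_le (eventually_le_of_bddAbove hC x))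

theorem upperSemicontinuousOn_upperEnvelope {u : EuclideanSpace ℝ (Fin n) → ℝ} {C : ℝ}
    (hC : ∀ y ∈ closure Ω, u y ≤ C) :
    UpperSemicontinuousOn (upperEnvelope Ω u) (closure Ω) := by
  intro x _ c hc
  obtain ⟨c', hc', hc'c⟩ := exists_between hc
  have h1 := eventually_eventually_nhdsWithin.2 (eventually_lt_of_upperEnvelope_lt hC hc')
  filter_upwards [h1, self_mem_nhdsWithin] with y hy hyc
  exact (upperEnvelope_le hyc (hy.mono fun _ h => h.le)).trans_lt hc'c

theorem upperEnvelope_eq_of_upperSemicontinuousOn {u : EuclideanSpace ℝ (Fin n) → ℝ} {C : ℝ}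
    (hC : ∀ y ∈ closure Ω, u y ≤ C) (hu : UpperSemicontinuousOn u (closure Ω))
    {x : EuclideanSpace ℝ (Fin n)} (hx : x ∈ closure Ω) : upperEnvelope Ω u x = u x := by
  refine le_antisymm ?_ ?_
  · exact le_of_forall_gt_imp_ge_of_dense fun c hc =>
      upperEnvelope_le hx ((hu x hx c hc).mono fun _ h => h.le)
  · exact le_of_forall_gt_imp_ge_of_dense fun c hc =>
      ((eventually_lt_of_upperEnvelope_lt hC hc).self_of_nhdsWithin hx).le

end Envelopes

/-! ### Return to the original definitions, and the conclusion -/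

namespace NeumannProblem

variable {n : ℕ} {Ω : Set (EuclideanSpace ℝ (Fin n))}
  {H : EuclideanSpace ℝ (Fin n) → EuclideanSpace ℝ (Fin n) → ℝ}
  {γ : EuclideanSpace ℝ (Fin n) → EuclideanSpace ℝ (Fin n)} {g : EuclideanSpace ℝ (Fin n) → ℝ}

theorem upperEnvelope_mem (P : NeumannProblem Ω H γ g) {a : ℝ}
    {u : EuclideanSpace ℝ (Fin n) → ℝ} (hu : IsSubsolution Ω H γ g a u) :
    upperEnvelope Ω u ∈ P.subsolutions a := by
  obtain ⟨⟨C, hC⟩, htest⟩ := hu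
  have hC' : ∀ y ∈ closure Ω, u y ≤ C := fun y hy => hC (mem_image_of_mem u hy)
  have husc := upperSemicontinuousOn_upperEnvelope hC'
  have hsub : ∀ x ∈ closure Ω, SubAt Ω H γ g a (upperEnvelope Ω u) x := by
    intro x hx p hp
    obtain ⟨φ, hφ, rfl, hmax⟩ := exists_global_test
      (fun y hy => upperEnvelope_le hy (eventually_le_of_bddAbove hC' y)) hp
    exact htest x hx φ hφ hmax
  refine ⟨LocallyLipschitzOn.continuousOn (locallyLipschitzOn_of_closedBall fun z hz => ?_), hsub⟩
  obtain ⟨R, hR, K, hK, h⟩ := P.exists_local_lipschitz a hz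
  exact ⟨R, hR, K, hK, h _ husc hsub⟩

theorem isSubsolution_of_mem (P : NeumannProblem Ω H γ g) {a : ℝ}
    {v : EuclideanSpace ℝ (Fin n) → ℝ} (hv : v ∈ P.subsolutions a) :
    IsSubsolution Ω H γ g a v := by
  refine ⟨P.isCompact_closure.bddAbove_image hv.1, fun x hx φ hφ hmax => ?_⟩
  refine hv.2 x hx _ ⟨φ, C1At.of_contDiffAt hφ.contDiffAt, ?_⟩
  filter_upwards [self_mem_nhdsWithin] with y hy
  have h := hmax hy
  simpa only [mem_ofPred_eq, upperEnvelope_eq hv.1 hy, upperEnvelope_eq hv.1 hx] using h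

theorem isSupersolution_iff (P : NeumannProblem Ω H γ g) {u : EuclideanSpace ℝ (Fin n) → ℝ}
    (hu : ContinuousOn u (closure Ω)) :
    IsSupersolution Ω H γ g 0 u ↔ ∀ x ∈ closure Ω, SuperAt Ω H γ g u x := by
  have hbdd := P.isCompact_closure.bddBelow_image hu
  constructor
  · rintro ⟨⟨C, hC⟩, htest⟩ x hx p hp
    obtain ⟨φ, hφ, rfl, hmax⟩ := exists_global_test (C := -C)
      (fun y hy => neg_le_neg (hC (mem_image_of_mem u hy))) hp
    have hgr : gradient (fun y => -φ y) x = -gradient φ x := by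
      simpa using ((C1At.of_contDiffAt hφ.contDiffAt).const_mul (-1)).gradient_eq
    rw [← hgr]
    refine htest x hx _ hφ.neg fun y hy => ?_
    have h := hmax hy
    simp only [mem_ofPred_eq] at h ⊢
    rw [lowerEnvelope_eq hu hy, lowerEnvelope_eq hu hx]
    linarith
  · refine fun h => ⟨hbdd, fun x hx φ hφ hmin => ?_⟩
    have hmem : -gradient φ x ∈ superdiff (closure Ω) (fun y => -u y) x := by
      refine ⟨fun y => -φ y, by simpa using (C1At.of_contDiffAt hφ.contDiffAt).const_mul (-1), ?_⟩
      filter_upwards [self_mem_nhdsWithin] with y hy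
      have h := hmin hy
      simp only [mem_ofPred_eq] at h
      rw [lowerEnvelope_eq hu hy, lowerEnvelope_eq hu hx] at h
      linarith
    simpa using h x hx _ hmem

/-- An upper semicontinuous subsolution equals its envelope on the closure, hence is continuous
there. The supremum is attained by `maxSub` itself. -/
theorem semidistance_eq (P : NeumannProblem Ω H γ g) (hne : (P.subsolutions 0).Nonempty)
    {x y : EuclideanSpace ℝ (Fin n)} (hx : x ∈ closure Ω) (hy : y ∈ closure Ω) :
    semidistance Ω H γ g 0 x y = (P.maxSub 0 y x : EReal) := by
  refine le_antisymm (sSup_le ?_) (le_sSup ?_)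
  · rintro _ ⟨v, husc, hv, rfl⟩
    obtain ⟨C, hC⟩ := hv.1
    have hC' : ∀ y ∈ closure Ω, v y ≤ C := fun y hy => hC (mem_image_of_mem v hy)
    have h := P.sub_le_maxSub hx hy (P.upperEnvelope_mem hv)
    rw [upperEnvelope_eq_of_upperSemicontinuousOn hC' husc hx,
      upperEnvelope_eq_of_upperSemicontinuousOn hC' husc hy] at h
    exact EReal.coe_le_coe_iff.2 h
  · have hmem := P.maxSub_mem hne hy
    exact ⟨P.maxSub 0 y, hmem.1.upperSemicontinuousOn, P.isSubsolution_of_mem hmem, by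
      rw [P.maxSub_self hne, sub_zero]⟩

/-- Everything else required of d(·, y) is automatic: it is a subsolution, and a supersolution away
from y by maximality. -/
theorem mem_aubryMatherSet_iff (P : NeumannProblem Ω H γ g) (hne : (P.subsolutions 0).Nonempty)
    {y : EuclideanSpace ℝ (Fin n)} :
    y ∈ aubryMatherSet Ω H γ g 0 ↔ y ∈ closure Ω ∧ SuperAt Ω H γ g (P.maxSub 0 y) y := by
  constructor
  · rintro ⟨hy, u, hu, hsol⟩
    have heq : EqOn u (P.maxSub 0 y) (closure Ω) := fun x hx =>
      EReal.coe_injective ((hu x hx).symm.trans (P.semidistance_eq hne hx hy))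
    have huc : ContinuousOn u (closure Ω) := (P.maxSub_mem hne hy).1.congr heq
    exact ⟨hy, superAt_congr heq hy ((P.isSupersolution_iff huc).1 hsol.2 y hy)⟩
  · rintro ⟨hy, hsup⟩
    have hmem := P.maxSub_mem hne hy
    refine ⟨hy, P.maxSub 0 y, fun x hx => P.semidistance_eq hne hx hy, P.isSubsolution_of_mem hmem,
      (P.isSupersolution_iff hmem.1).2 fun x hx => ?_⟩
    by_cases hxy : x = y
    · rwa [hxy]
    · exact P.superAt_maxSub_of_ne hne hx hy hxy

theorem isCompact_aubryMatherSet (P : NeumannProblem Ω H γ g)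
    (hne : (P.subsolutions 0).Nonempty) : IsCompact (aubryMatherSet Ω H γ g 0) := by
  refine P.isCompact_closure.of_isClosed_subset (IsSeqClosed.isClosed ?_) fun y hy => hy.1
  intro y z hy hyz
  simp only [P.mem_aubryMatherSet_iff hne] at hy ⊢
  refine ⟨isClosed_closure.mem_of_tendsto hyz (Eventually.of_forall fun k => (hy k).1),
    P.superAt_of_tendsto hne (fun k => (hy k).1) hyz fun k x hx => ?_⟩
  by_cases hxy : x = y k
  · rw [hxy]
    exact (hy k).2
  · exact P.superAt_maxSub_of_ne hne hx (hy k).1 hxy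

theorem subsolutions_nonempty_of_criticalValue (P : NeumannProblem Ω H γ g)
    (hc : criticalValue Ω H γ g = 0) {a : ℝ} (ha : 0 < a) : (P.subsolutions a).Nonempty := by
  have h1 : criticalValue Ω H γ g < (a : EReal) := by
    rw [hc]
    exact_mod_cast ha
  obtain ⟨_, ⟨b, rfl, u, hu⟩, hba⟩ := sInf_lt_iff.1 h1
  exact ⟨_, P.subsolutions_mono (EReal.coe_lt_coe_iff.1 hba).le (P.upperEnvelope_mem hu)⟩

theorem aubryMatherSet_nonempty (P : NeumannProblem Ω H γ g)
    (hne : (P.subsolutions 0).Nonempty) (hc : criticalValue Ω H γ g = 0) :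
    (aubryMatherSet Ω H γ g 0).Nonempty := by
  by_contra hcon
  rw [Set.not_nonempty_iff_eq_empty] at hcon
  obtain ⟨ε, hε, w, hw⟩ := P.exists_neg_level hne fun y hy hsup => by
    have := (P.mem_aubryMatherSet_iff hne).2 ⟨hy, hsup⟩
    rw [hcon] at this
    exact this
  have h1 : criticalValue Ω H γ g ≤ ((-ε : ℝ) : EReal) :=
    sInf_le ⟨-ε, rfl, w, P.isSubsolution_of_mem hw⟩
  rw [hc] at h1
  have h2 : (0 : ℝ) ≤ -ε := by exact_mod_cast h1
  linarith

end NeumannProblem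

theorem isChart_of_isLocalDefiningFunction {n : ℕ} {Ω : Set (EuclideanSpace ℝ (Fin n))}
    {z : EuclideanSpace ℝ (Fin n)} {ρ : EuclideanSpace ℝ (Fin n) → ℝ}
    (h : IsLocalDefiningFunction Ω z ρ) : IsChart Ω ρ z :=
  ⟨C1At.of_contDiffAt h.1, h.2.1, h.2.2⟩

end NeumannHJ

theorem theorem6p1 {n : ℕ} (Ω : Set (EuclideanSpace ℝ (Fin n)))
    (hΩ_open : IsOpen Ω) (hΩ_conn : IsConnected Ω) (hΩ_bdd : Bornology.IsBounded Ω)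
    (hΩ_C1 : NeumannHJ.HasC1Boundary Ω)
    (H : EuclideanSpace ℝ (Fin n) → EuclideanSpace ℝ (Fin n) → ℝ)
    (hH_cont : ContinuousOn
      (fun q : EuclideanSpace ℝ (Fin n) × EuclideanSpace ℝ (Fin n) => H q.1 q.2)
      (closure Ω ×ˢ Set.univ))
    (hH_convex : ∀ x ∈ closure Ω, ConvexOn ℝ Set.univ (H x))
    (hH_coercive : ∀ x ∈ closure Ω,
      Filter.Tendsto (H x) (Bornology.cobounded (EuclideanSpace ℝ (Fin n))) Filter.atTop)
    (γ : EuclideanSpace ℝ (Fin n) → EuclideanSpace ℝ (Fin n))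
    (hγ_cont : ContinuousOn γ (frontier Ω)) (hγ_oblique : NeumannHJ.IsOblique Ω γ)
    (g : EuclideanSpace ℝ (Fin n) → ℝ) (hg_cont : ContinuousOn g (frontier Ω))
    (hc : NeumannHJ.criticalValue Ω H γ g = 0) :
    (NeumannHJ.aubryMatherSet Ω H γ g 0).Nonempty ∧
      IsCompact (NeumannHJ.aubryMatherSet Ω H γ g 0) := by
  have P : NeumannHJ.NeumannProblem Ω H γ g := by
    refine ⟨hΩ_open, hΩ_bdd, hΩ_conn, fun z hz => ?_, hH_cont, hH_convex, hH_coercive, hγ_cont,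
      hg_cont⟩
    obtain ⟨ρ, hρ⟩ := hΩ_C1 z hz
    refine ⟨ρ, NeumannHJ.isChart_of_isLocalDefiningFunction hρ, ?_⟩
    have h := hγ_oblique z hz _ ⟨ρ, hρ, rfl⟩
    rw [real_inner_smul_left] at h
    exact pos_of_mul_pos_right h (inv_nonneg.2 (norm_nonneg _))
  have hne := P.subsolutions_zero_nonempty fun a ha =>
    P.subsolutions_nonempty_of_criticalValue hc ha
  exact ⟨P.aubryMatherSet_nonempty hne hc, P.isCompact_aubryMatherSet hne⟩
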